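/- Let $\mathbb D=\{z\in\mathbb C:|z|\le 1\}$, let $d^2z$ be Lebesgue measure on $\mathbb D$, and let $d\mu=(1+|z|^2)^{-2}\,d^2z$. The Riemann sphere is regarded as two copies of $\mathbb D$ glued along their boundary circles by $z\mapsto 1/z$. Put $$\mathcal H_1=L^2(\mathbb D,d\mu)\oplus L^2(\mathbb D,d\mu),\qquad \mathcal H_2=L^2(\mathbb D,d^2z)\oplus L^2(\mathbb D,d^2z).$$ Let $D$ be the d-bar operator from $\mathcal H_1$ to $\mathcal H_2$ given by $D(u,v)=(\partial u/\partial\bar z,\ \partial v/\partial\bar z)$ (weak derivatives) on the domain $$\operatorname{dom}(D)=\{(u,v)\in\mathcal H_1:\ u,v\in H^1(\mathbb D)\ \text{and}\ u(z)=v(1/z)\ \text{for}\ |z|=1\},$$ where $H^1(\mathbb D)$ is the first Sobolev space and the boundary condition is understood in the sense of Sobolev traces, almost everywhere on the circle. Then: 1. $D$ is right invertible: there is a bounded operator $Q:\mathcal H_2\to\mathcal H_1$ with range in $\operatorname{dom}(D)$ and $DQ=I$. 2. $D$ is left invertible modulo compact operators: there are a bounded operator $Q:\mathcal H_2\to\mathcal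 H_1$ and a compact operator $K$ on $\mathcal H_1$ with $QDx=x+Kx$ for all $x\in\operatorname{dom}(D)$. 3. $D$ has a compact parametrix: there is a compact operator $Q:\mathcal H_2\to\mathcal H_1$ with range in $\operatorname{dom}(D)$ such that $DQ-I$ is compact on $\mathcal H_2$ and $QD-I$ agrees on $\operatorname{dom}(D)$ with a compact operator on $\mathcal H_1$. Moreover $Q$ can be chosen such that $DQ=I$. -/

import Mathlib

open MeasureTheory Filter Topology
open scoped ContDiff ENNReal

noncomputable section

namespace GluedDisks

/-- The closed unit disk `{z : |z| ≤ 1}` in the complex plane. -/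
def disk : Set ℂ := Metric.closedBall 0 1

/-- Lebesgue measure `d²z` on the unit disk. -/
def lebDisk : Measure ℂ := volume.restrict disk

/-- The Fubini-Study measure `dμ = (1 + |z|²)⁻² d²z` on the unit disk. -/
def fsDisk : Measure ℂ :=
  lebDisk.withDensity fun z => ENNReal.ofReal (1 / (1 + ‖z‖ ^ 2) ^ 2)

/-- Arc length on the unit circle `|z| = 1`, as a measure on `ℂ`. -/
def arcLength : Measure ℂ :=
  Measure.map (fun θ : ℝ => Complex.exp (θ * Complex.I))
    (volume.restrict (Set.Ioc (-Real.pi) Real.pi))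

/-- The Hilbert space of functions on the sphere, `L²(𝔻, dμ) ⊕ L²(𝔻, dμ)`. -/
abbrev FunctionSpace : Type := WithLp 2 (Lp ℂ 2 fsDisk × Lp ℂ 2 fsDisk)

/-- The Hilbert space of `(0,1)`-forms on the sphere, `L²(𝔻, d²z) ⊕ L²(𝔻, d²z)`. -/
abbrev FormSpace : Type := WithLp 2 (Lp ℂ 2 lebDisk × Lp ℂ 2 lebDisk)

/-- `g` is the weak derivative of `u` in the (real) direction `e` on the open unit disk:
`∫ u ∂ₑφ = - ∫ g φ` for every smooth `φ` with compact support in the open unit disk. -/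
def IsWeakDeriv (e : ℂ) (u g : ℂ → ℂ) : Prop :=
  ∀ φ : ℂ → ℂ, ContDiff ℝ ∞ φ → HasCompactSupport φ → tsupport φ ⊆ Metric.ball 0 1 →
    ∫ z, u z * fderiv ℝ φ z e ∂lebDisk = - ∫ z, g z * φ z ∂lebDisk

/-- `u` is in the Sobolev space `H¹(𝔻)`, with weak partial derivatives `∂u/∂x = ux` and
`∂u/∂y = uy`. -/
structure IsSobolev (u ux uy : ℂ → ℂ) : Prop where
  memLp : MemLp u 2 lebDisk
  memLp_x : MemLp ux 2 lebDisk
  memLp_y : MemLp uy 2 lebDisk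
  weak_x : IsWeakDeriv 1 u ux
  weak_y : IsWeakDeriv Complex.I u uy

/-- `u ∈ H¹(𝔻)`. -/
def MemSobolev (u : ℂ → ℂ) : Prop := ∃ ux uy : ℂ → ℂ, IsSobolev u ux uy

/-- `g ∈ L²(∂𝔻)` is the boundary value (Sobolev trace) of `u ∈ H¹(𝔻)`: some sequence of functions
which are smooth up to the boundary converges to `u` in `H¹(𝔻)`, and its restrictions to the unit
circle converge to `g` in `L²(∂𝔻)`. -/
def IsTrace (u g : ℂ → ℂ) : Prop :=
  MemLp g 2 arcLength ∧
  ∃ ux uy : ℂ → ℂ, IsSobolev u ux uy ∧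
  ∃ w : ℕ → ℂ → ℂ, (∀ k, ContDiff ℝ ∞ (w k)) ∧
    Tendsto (fun k => eLpNorm (fun z => w k z - u z) 2 lebDisk) atTop (𝓝 0) ∧
    Tendsto (fun k => eLpNorm (fun z => fderiv ℝ (w k) z 1 - ux z) 2 lebDisk) atTop (𝓝 0) ∧
    Tendsto (fun k => eLpNorm (fun z => fderiv ℝ (w k) z Complex.I - uy z) 2 lebDisk)
      atTop (𝓝 0) ∧
    Tendsto (fun k => eLpNorm (fun z => w k z - g z) 2 arcLength) atTop (𝓝 0)

/-- The gluing condition `u(z) = v(1/z)` when `|z| = 1`, in the sense of boundary values. -/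
def Glue (u v : ℂ → ℂ) : Prop :=
  ∃ g h : ℂ → ℂ, IsTrace u g ∧ IsTrace v h ∧ ∀ᵐ z ∂arcLength, g z = h (1 / z)

/-! Basic facts that make the operator well defined. -/

theorem disk_measurable : MeasurableSet disk := Metric.isClosed_closedBall.measurableSet

instance : IsFiniteMeasure lebDisk := by
  constructor
  rw [lebDisk, Measure.restrict_apply_univ]
  exact (isCompact_closedBall (0 : ℂ) 1).measure_lt_top

theorem lebDisk_ac : lebDisk ≪ fsDisk := by
  refine withDensity_absolutelyContinuous' ?_ ?_
  · refine Measurable.aemeasurable ?_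
    fun_prop
  · refine Eventually.of_forall fun z => ?_
    have h : (0 : ℝ) < 1 / (1 + ‖z‖ ^ 2) ^ 2 := by positivity
    exact (ENNReal.ofReal_pos.2 h).ne'

theorem coeFn_add_lebDisk (u v : Lp ℂ 2 fsDisk) :
    (u : ℂ → ℂ) + (v : ℂ → ℂ) =ᵐ[lebDisk] ((u + v : Lp ℂ 2 fsDisk) : ℂ → ℂ) :=
  EventuallyEq.symm (lebDisk_ac.ae_le (Lp.coeFn_add u v))

theorem coeFn_smul_lebDisk (c : ℂ) (u : Lp ℂ 2 fsDisk) :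
    c • (u : ℂ → ℂ) =ᵐ[lebDisk] ((c • u : Lp ℂ 2 fsDisk) : ℂ → ℂ) :=
  EventuallyEq.symm (lebDisk_ac.ae_le (Lp.coeFn_smul c u))

theorem integrable_mul_test {u φ : ℂ → ℂ} (hu : MemLp u 2 lebDisk) (hφ : Continuous φ) :
    Integrable (fun z => u z * φ z) lebDisk := by
  have hu1 : IntegrableOn u disk volume := hu.integrable (by norm_num)
  exact hu1.mul_continuousOn hφ.continuousOn (isCompact_closedBall _ _)

theorem continuous_fderiv_apply {φ : ℂ → ℂ} (hφ : ContDiff ℝ ∞ φ) (e : ℂ) :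
    Continuous fun z => fderiv ℝ φ z e :=
  (hφ.continuous_fderiv (by simp)).clm_apply continuous_const

theorem IsWeakDeriv.congr {e : ℂ} {u u' g g' : ℂ → ℂ} (h : IsWeakDeriv e u g)
    (hu : u =ᵐ[lebDisk] u') (hg : g =ᵐ[lebDisk] g') : IsWeakDeriv e u' g' := by
  intro φ h1 h2 h3
  rw [← integral_congr_ae (hu.mono fun z hz => by simp only [hz] :
      (fun z => u z * fderiv ℝ φ z e) =ᵐ[lebDisk] fun z => u' z * fderiv ℝ φ z e),
    ← integral_congr_ae (hg.mono fun z hz => by simp only [hz] :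
      (fun z => g z * φ z) =ᵐ[lebDisk] fun z => g' z * φ z)]
  exact h φ h1 h2 h3

theorem IsWeakDeriv.add {e : ℂ} {u u' g g' : ℂ → ℂ} (h : IsWeakDeriv e u g)
    (h' : IsWeakDeriv e u' g') (hu : MemLp u 2 lebDisk) (hu' : MemLp u' 2 lebDisk)
    (hg : MemLp g 2 lebDisk) (hg' : MemLp g' 2 lebDisk) :
    IsWeakDeriv e (u + u') (g + g') := by
  intro φ h1 h2 h3
  have c := continuous_fderiv_apply h1 e
  simp only [Pi.add_apply, add_mul]
  rw [integral_add (integrable_mul_test hu c) (integrable_mul_test hu' c),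
    integral_add (integrable_mul_test hg h1.continuous) (integrable_mul_test hg' h1.continuous),
    h φ h1 h2 h3, h' φ h1 h2 h3]
  ring

theorem IsWeakDeriv.smul {e : ℂ} {u g : ℂ → ℂ} (c : ℂ) (h : IsWeakDeriv e u g) :
    IsWeakDeriv e (c • u) (c • g) := by
  intro φ h1 h2 h3
  simp only [Pi.smul_apply, smul_eq_mul, mul_assoc]
  rw [integral_const_mul, integral_const_mul, h φ h1 h2 h3]
  ring

theorem IsWeakDeriv.unique {e : ℂ} {u g g' : ℂ → ℂ} (h : IsWeakDeriv e u g)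
    (h' : IsWeakDeriv e u g') (hg : MemLp g 2 lebDisk) (hg' : MemLp g' 2 lebDisk) :
    g =ᵐ[lebDisk] g' := by
  have hint : IntegrableOn (g - g') disk volume := (hg.sub hg').integrable (by norm_num)
  have key : ∀ᵐ z ∂volume, z ∈ Metric.ball (0 : ℂ) 1 → (g - g') z = 0 := by
    refine Metric.isOpen_ball.ae_eq_zero_of_integral_contDiff_smul_eq_zero
      (hint.mono_set Metric.ball_subset_closedBall).locallyIntegrableOn ?_
    intro ψ s1 s2 s3
    have t1 : ContDiff ℝ ∞ (fun z => (ψ z : ℂ)) := Complex.ofRealCLM.contDiff.comp s1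
    have t2 : HasCompactSupport (fun z => (ψ z : ℂ)) :=
      s2.comp_left (g := Complex.ofReal) Complex.ofReal_zero
    have t3 : tsupport (fun z => (ψ z : ℂ)) ⊆ Metric.ball 0 1 := by
      refine (closure_mono ?_).trans s3
      intro z hz
      simpa using hz
    have e1 := (h _ t1 t2 t3).symm.trans (h' _ t1 t2 t3)
    have e2 : ∫ z, (g - g') z * (ψ z : ℂ) ∂lebDisk = 0 := by
      simp only [Pi.sub_apply, sub_mul]
      rw [integral_sub (integrable_mul_test hg t1.continuous)
        (integrable_mul_test hg' t1.continuous), sub_eq_zero]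
      exact neg_injective e1
    rw [← e2, lebDisk, ← integral_indicator disk_measurable]
    refine integral_congr_ae (Eventually.of_forall fun z => ?_)
    by_cases hz : z ∈ disk
    · simp only [Set.indicator_of_mem hz, Complex.real_smul, mul_comm]
    · have : ψ z = 0 := by
        by_contra hne
        exact hz (Metric.ball_subset_closedBall (s3 (subset_tsupport _ hne)))
      simp [this, Set.indicator_of_notMem hz]
  have hs : ∀ᵐ z ∂(volume : Measure ℂ), z ∉ Metric.sphere (0 : ℂ) 1 :=
    measure_eq_zero_iff_ae_notMem.1 (Measure.addHaar_sphere _ _ _)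
  rw [lebDisk, EventuallyEq, ae_restrict_iff' disk_measurable]
  filter_upwards [key, hs] with z h1 h2 h3
  have : z ∈ Metric.ball (0 : ℂ) 1 := by
    rw [disk, ← Metric.ball_union_sphere] at h3
    exact h3.resolve_right h2
  exact sub_eq_zero.1 (h1 this)

theorem IsSobolev.congr {u u' ux uy : ℂ → ℂ} (h : IsSobolev u ux uy) (hu : u =ᵐ[lebDisk] u') :
    IsSobolev u' ux uy :=
  ⟨h.memLp.ae_eq hu, h.memLp_x, h.memLp_y, h.weak_x.congr hu (ae_eq_refl _),
    h.weak_y.congr hu (ae_eq_refl _)⟩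

theorem IsSobolev.add {u ux uy v vx vy : ℂ → ℂ} (h : IsSobolev u ux uy) (k : IsSobolev v vx vy) :
    IsSobolev (u + v) (ux + vx) (uy + vy) :=
  ⟨h.memLp.add k.memLp, h.memLp_x.add k.memLp_x, h.memLp_y.add k.memLp_y,
    h.weak_x.add k.weak_x h.memLp k.memLp h.memLp_x k.memLp_x,
    h.weak_y.add k.weak_y h.memLp k.memLp h.memLp_y k.memLp_y⟩

theorem IsSobolev.smul {u ux uy : ℂ → ℂ} (c : ℂ) (h : IsSobolev u ux uy) :
    IsSobolev (c • u) (c • ux) (c • uy) :=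
  ⟨h.memLp.const_smul c, h.memLp_x.const_smul c, h.memLp_y.const_smul c,
    h.weak_x.smul c, h.weak_y.smul c⟩

theorem IsSobolev.zero : IsSobolev 0 0 0 := by
  refine ⟨MemLp.zero, MemLp.zero, MemLp.zero, ?_, ?_⟩ <;> intro φ _ _ _ <;> simp

theorem tendsto_eLpNorm_add {m : Measure ℂ} {a b : ℕ → ℂ → ℂ} {c : ℕ → ℂ → ℂ}
    (hc : ∀ k z, c k z = a k z + b k z)
    (ma : ∀ k, AEStronglyMeasurable (a k) m) (mb : ∀ k, AEStronglyMeasurable (b k) m)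
    (ha : Tendsto (fun k => eLpNorm (a k) 2 m) atTop (𝓝 0))
    (hb : Tendsto (fun k => eLpNorm (b k) 2 m) atTop (𝓝 0)) :
    Tendsto (fun k => eLpNorm (c k) 2 m) atTop (𝓝 0) := by
  have hab : Tendsto (fun k => eLpNorm (a k) 2 m + eLpNorm (b k) 2 m) atTop (𝓝 0) := by
    simpa using ha.add hb
  refine tendsto_of_tendsto_of_tendsto_of_le_of_le tendsto_const_nhds hab
    (fun _ => zero_le) fun k => ?_
  have : c k = a k + b k := funext (hc k)
  simpa only [this] using eLpNorm_add_le (ma k) (mb k) (by norm_num)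

theorem tendsto_eLpNorm_smul {m : Measure ℂ} {a : ℕ → ℂ → ℂ} {b : ℕ → ℂ → ℂ} (c : ℂ)
    (hb : ∀ k z, b k z = c * a k z)
    (ha : Tendsto (fun k => eLpNorm (a k) 2 m) atTop (𝓝 0)) :
    Tendsto (fun k => eLpNorm (b k) 2 m) atTop (𝓝 0) := by
  have e : (fun k => eLpNorm (b k) 2 m) = fun k => ‖c‖ₑ * eLpNorm (a k) 2 m := by
    funext k
    have : b k = c • a k := funext (hb k)
    rw [this, eLpNorm_const_smul]
  rw [e]
  simpa using ENNReal.Tendsto.const_mul ha (Or.inr enorm_ne_top)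

theorem IsTrace.congr {u u' g : ℂ → ℂ} (h : IsTrace u g) (hu : u =ᵐ[lebDisk] u') :
    IsTrace u' g := by
  obtain ⟨hg, ux, uy, hs, w, w1, w2, w3, w4, w5⟩ := h
  refine ⟨hg, ux, uy, hs.congr hu, w, w1, ?_, w3, w4, w5⟩
  refine w2.congr fun k => eLpNorm_congr_ae (hu.mono fun z hz => ?_)
  simp only [hz]

theorem IsTrace.add {u g v h : ℂ → ℂ} (hu : IsTrace u g) (hv : IsTrace v h) :
    IsTrace (u + v) (g + h) := by
  obtain ⟨hg, ux, uy, hs, w, w1, w2, w3, w4, w5⟩ := hu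
  obtain ⟨hh, vx, vy, ht, y, y1, y2, y3, y4, y5⟩ := hv
  have fd : ∀ k z e, fderiv ℝ (w k + y k) z e = fderiv ℝ (w k) z e + fderiv ℝ (y k) z e := by
    intro k z e
    rw [fderiv_add ((w1 k).differentiable (by simp) z) ((y1 k).differentiable (by simp) z)]
    rfl
  have cw := fun k => (w1 k).continuous.aestronglyMeasurable (μ := lebDisk)
  have cy := fun k => (y1 k).continuous.aestronglyMeasurable (μ := lebDisk)
  have dw := fun e k => (continuous_fderiv_apply (w1 k) e).aestronglyMeasurable (μ := lebDisk)
  have dy := fun e k => (continuous_fderiv_apply (y1 k) e).aestronglyMeasurable (μ := lebDisk)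
  refine ⟨hg.add hh, _, _, hs.add ht, fun k => w k + y k, fun k => (w1 k).add (y1 k),
    tendsto_eLpNorm_add ?_ (fun k => (cw k).sub hs.memLp.1) (fun k => (cy k).sub ht.memLp.1) w2 y2,
    tendsto_eLpNorm_add ?_ (fun k => (dw _ k).sub hs.memLp_x.1)
      (fun k => (dy _ k).sub ht.memLp_x.1) w3 y3,
    tendsto_eLpNorm_add ?_ (fun k => (dw _ k).sub hs.memLp_y.1)
      (fun k => (dy _ k).sub ht.memLp_y.1) w4 y4,
    tendsto_eLpNorm_add ?_ (fun k => (w1 k).continuous.aestronglyMeasurable.sub hg.1)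
      (fun k => (y1 k).continuous.aestronglyMeasurable.sub hh.1) w5 y5⟩
  all_goals
    intro k z
    simp only [fd, Pi.add_apply, Pi.sub_apply]
    ring

theorem IsTrace.smul {u g : ℂ → ℂ} (c : ℂ) (hu : IsTrace u g) : IsTrace (c • u) (c • g) := by
  obtain ⟨hg, ux, uy, hs, w, w1, w2, w3, w4, w5⟩ := hu
  have fd : ∀ k z e, fderiv ℝ (c • w k) z e = c * fderiv ℝ (w k) z e := by
    intro k z e
    rw [fderiv_const_smul ((w1 k).differentiable (by simp) z)]
    rfl
  refine ⟨hg.const_smul c, _, _, hs.smul c, fun k => c • w k, fun k => (w1 k).const_smul c,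
    tendsto_eLpNorm_smul c ?_ w2, tendsto_eLpNorm_smul c ?_ w3, tendsto_eLpNorm_smul c ?_ w4,
    tendsto_eLpNorm_smul c ?_ w5⟩
  all_goals
    intro k z
    simp only [fd, Pi.smul_apply, smul_eq_mul]
    ring

theorem IsTrace.zero : IsTrace 0 0 := by
  refine ⟨MemLp.zero, 0, 0, IsSobolev.zero, fun _ => 0, fun _ => contDiff_const, ?_, ?_, ?_, ?_⟩ <;>
  · have : (fun _ : ℂ => (0 : ℂ)) = 0 := rfl
    simp [this]

/-- The domain `{(u, v) : u, v ∈ H¹(𝔻) and u(z) = v(1/z) when |z| = 1}` of the d-bar operator. -/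
def dom : Submodule ℂ FunctionSpace where
  carrier := {x | MemSobolev x.fst ∧ MemSobolev x.snd ∧ Glue x.fst x.snd}
  zero_mem' := by
    have e : ((0 : Lp ℂ 2 fsDisk) : ℂ → ℂ) =ᵐ[lebDisk] 0 := lebDisk_ac.ae_le (Lp.coeFn_zero ..)
    exact ⟨⟨0, 0, IsSobolev.zero.congr e.symm⟩, ⟨0, 0, IsSobolev.zero.congr e.symm⟩,
      0, 0, IsTrace.zero.congr e.symm, IsTrace.zero.congr e.symm, by simp⟩
  add_mem' := by
    rintro x y ⟨⟨_, _, a⟩, ⟨_, _, b⟩, g, h, t1, t2, t3⟩ ⟨⟨_, _, a'⟩, ⟨_, _, b'⟩, g', h', s1, s2, s3⟩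
    have e := coeFn_add_lebDisk x.fst y.fst
    have f := coeFn_add_lebDisk x.snd y.snd
    refine ⟨⟨_, _, (a.add a').congr e⟩, ⟨_, _, (b.add b').congr f⟩,
      g + g', h + h', (t1.add s1).congr e, (t2.add s2).congr f, ?_⟩
    filter_upwards [t3, s3] with z h1 h2
    simp only [Pi.add_apply, h1, h2]
  smul_mem' := by
    rintro c x ⟨⟨_, _, a⟩, ⟨_, _, b⟩, g, h, t1, t2, t3⟩
    have e := coeFn_smul_lebDisk c x.fst
    have f := coeFn_smul_lebDisk c x.snd
    refine ⟨⟨_, _, (a.smul c).congr e⟩, ⟨_, _, (b.smul c).congr f⟩,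
      c • g, c • h, (t1.smul c).congr e, (t2.smul c).congr f, ?_⟩
    filter_upwards [t3] with z h1
    simp only [Pi.smul_apply, h1]

/-- The weak `∂u/∂z̄ = (∂u/∂x + i ∂u/∂y)/2 ∈ L²(𝔻, d²z)` of `u ∈ H¹(𝔻)`. -/
def dbarFun (u : ℂ → ℂ) (hu : MemSobolev u) : Lp ℂ 2 lebDisk :=
  (1 / 2 : ℂ) • (hu.choose_spec.choose_spec.memLp_x.toLp _ +
    Complex.I • hu.choose_spec.choose_spec.memLp_y.toLp _)

/-- `dbarFun` does not depend on the representatives of the weak derivatives. -/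
theorem dbarFun_eq {u ux uy : ℂ → ℂ} (hu : MemSobolev u) (h : IsSobolev u ux uy) :
    dbarFun u hu = (1 / 2 : ℂ) • (h.memLp_x.toLp _ + Complex.I • h.memLp_y.toLp _) := by
  have s := hu.choose_spec.choose_spec
  rw [dbarFun, (MemLp.toLp_eq_toLp_iff _ h.memLp_x).2
      (s.weak_x.unique h.weak_x s.memLp_x h.memLp_x),
    (MemLp.toLp_eq_toLp_iff _ h.memLp_y).2 (s.weak_y.unique h.weak_y s.memLp_y h.memLp_y)]

theorem dbarFun_add {u v w : ℂ → ℂ} (hu : MemSobolev u) (hv : MemSobolev v) (hw : MemSobolev w)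
    (e : u + v =ᵐ[lebDisk] w) : dbarFun w hw = dbarFun u hu + dbarFun v hv := by
  obtain ⟨ux, uy, su⟩ := id hu
  obtain ⟨vx, vy, sv⟩ := id hv
  rw [dbarFun_eq hw ((su.add sv).congr e), dbarFun_eq hu su, dbarFun_eq hv sv,
    MemLp.toLp_add su.memLp_x sv.memLp_x, MemLp.toLp_add su.memLp_y sv.memLp_y]
  module

theorem dbarFun_smul {u w : ℂ → ℂ} (c : ℂ) (hu : MemSobolev u) (hw : MemSobolev w)
    (e : c • u =ᵐ[lebDisk] w) : dbarFun w hw = c • dbarFun u hu := by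
  obtain ⟨ux, uy, su⟩ := id hu
  rw [dbarFun_eq hw ((su.smul c).congr e), dbarFun_eq hu su,
    MemLp.toLp_const_smul c su.memLp_x, MemLp.toLp_const_smul c su.memLp_y]
  module

/-- The d-bar operator `D(u, v) = (∂u/∂z̄, ∂v/∂z̄)` on the sphere, with domain `dom`. -/
def dbar : FunctionSpace →ₗ.[ℂ] FormSpace where
  domain := dom
  toFun :=
    { toFun := fun x => WithLp.toLp 2
        (dbarFun (x : FunctionSpace).fst x.2.1, dbarFun (x : FunctionSpace).snd x.2.2.1)
      map_add' := fun x y => congrArg₂ (fun p q => WithLp.toLp 2 (p, q))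
        (dbarFun_add x.2.1 y.2.1 (x + y).2.1 (coeFn_add_lebDisk _ _))
        (dbarFun_add x.2.2.1 y.2.2.1 (x + y).2.2.1 (coeFn_add_lebDisk _ _))
      map_smul' := fun c x => congrArg₂ (fun p q => WithLp.toLp 2 (p, q))
        (dbarFun_smul c x.2.1 (c • x).2.1 (coeFn_smul_lebDisk _ _))
        (dbarFun_smul c x.2.2.1 (c • x).2.2.1 (coeFn_smul_lebDisk _ _)) }

section Operators

variable {E F : Type*} [NormedAddCommGroup E] [NormedSpace ℂ E]
  [NormedAddCommGroup F] [NormedSpace ℂ F]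

/-- The bounded operator `Q` maps into the domain of `D`, and `D Q = I`. -/
def IsRightInverse (D : E →ₗ.[ℂ] F) (Q : F →L[ℂ] E) : Prop :=
  ∀ y : F, ∃ h : Q y ∈ D.domain, D ⟨Q y, h⟩ = y

/-- The bounded operator `Q` maps into the domain of `D`, and `D Q = I + K` with `K` compact. -/
def IsRightInverseModCompact (D : E →ₗ.[ℂ] F) (Q : F →L[ℂ] E) : Prop :=
  ∃ K : F →L[ℂ] F, IsCompactOperator K ∧ ∀ y : F, ∃ h : Q y ∈ D.domain, D ⟨Q y, h⟩ = y + K y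

/-- `Q D = I + K` on the domain of `D`, with `K` compact. -/
def IsLeftInverseModCompact (D : E →ₗ.[ℂ] F) (Q : F →L[ℂ] E) : Prop :=
  ∃ K : E →L[ℂ] E, IsCompactOperator K ∧ ∀ x : D.domain, Q (D x) = (x : E) + K x

/-- A parametrix of `D` is a bounded two-sided inverse modulo compact operators. -/
def IsParametrix (D : E →ₗ.[ℂ] F) (Q : F →L[ℂ] E) : Prop :=
  IsRightInverseModCompact D Q ∧ IsLeftInverseModCompact D Q

end Operators

end GluedDisks

end

/-!
The proof works on a dense core and extends by continuity; no integral formula for the inverse of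
`∂̄` is needed.

The core `gluedPairs` consists of the pairs `(u, v)` of smooth functions with `u(z) = v(1/z)` on
the circle and with mean value zero there. On the core the d-bar operator controls the whole
gradient (`energy_identity`): `|∂u|² - |∂̄u|²` is, up to a constant, the differential of the form
`ū du`, so by Stokes' theorem its integral over the disk is a boundary term, and the gluing
`z ↦ 1/z` reverses the circle, so that the boundary terms of the two disks cancel. The Poincaré
inequality on convex sets (`poincare_convex`) and the trace inequality (`trace_inequality`) then
bound the `H¹` norm and the boundary values of `(u, v)` by `‖D(u, v)‖` (`norm_le_of_mean_zero`).

The range of `D` on the core is dense (`denseRange_dbarCore`): it contains every pair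
`(zᵃ z̄ᵇ, 0)`, and by symmetry `(0, zᵃ z̄ᵇ)`, because the primitive `z^a z̄^(b+1) / (b+1)` equals
`z^(a-b-1) / (b+1)` on the circle, which extends holomorphically to one of the two disks. These
pairs span a dense subspace by the Stone-Weierstrass theorem. Hence the inverse of `D` on the core
extends to a bounded operator `dbarInv`. Convergence of `D s` forces convergence of `s` in `H¹` and
of the boundary values, so `dbarInv` maps into the domain of `D` and is a right inverse
(`isRightInverse_dbarInv`). It is compact (`isCompactOperator_dbarInv`), since by the Poincaré
inequality on the cells of a fine grid the `L²` norm is controlled by finitely many averages and a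
small multiple of the gradient.

The kernel of `D` is finite-dimensional (`finiteDimensional_ker_dbar`): Green's formula shows that
the boundary values of `u` and `v` have no negative Fourier coefficients, and the gluing exchanges
positive and negative frequencies, so `u` and `v` are constant. With `P` the orthogonal projection
onto the kernel, `Q = (1 - P) dbarInv` satisfies `D Q = 1` and `Q D = 1 - P`
(`exists_parametrix`), and this one operator has all the required properties.
-/

noncomputable section

namespace GluedDisks

/-! ### The divergence theorem on the disk -/

theorem integral_arcLength {E : Type*} [NormedAddCommGroup E] [NormedSpace ℝ E] (f : ℂ → E)
    (hf : AEStronglyMeasurable f arcLength) :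
    ∫ z, f z ∂arcLength = ∫ θ in -Real.pi..Real.pi, f (Complex.exp (θ * Complex.I)) := by
  rw [intervalIntegral.integral_of_le (by linarith [Real.pi_pos]), arcLength, integral_map]
  · exact (by fun_prop : Measurable _).aemeasurable
  · exact hf

/-- Integration over the disk in polar coordinates. -/
theorem lebDisk_polar {E : Type*} [NormedAddCommGroup E] [NormedSpace ℝ E] {f : ℂ → E}
    (hf : Continuous f) :
    ∫ z, f z ∂lebDisk = ∫ θ in -Real.pi..Real.pi, ∫ r in (0 : ℝ)..1,
      r • f (r * Complex.exp (θ * Complex.I)) := by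
  have hpi : -Real.pi ≤ Real.pi := by linarith [Real.pi_pos]
  have hcont : Continuous fun p : ℝ × ℝ => p.1 • f (p.1 * Complex.exp (p.2 * Complex.I)) := by
    fun_prop
  rw [lebDisk, ← integral_indicator disk_measurable, ← Complex.integral_comp_polarCoord_symm]
  have e1 : ∀ p ∈ polarCoord.target,
      p.1 • disk.indicator f (Complex.polarCoord.symm p) =
      (Set.Ioc (0 : ℝ) 1 ×ˢ Set.univ).indicator
        (fun p : ℝ × ℝ => p.1 • f (p.1 * Complex.exp (p.2 * Complex.I))) p := by
    rintro ⟨r, θ⟩ hp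
    have hr : 0 < r := hp.1
    have e : Complex.polarCoord.symm (r, θ) = r * Complex.exp (θ * Complex.I) := by
      rw [Complex.polarCoord_symm_apply, Complex.exp_mul_I]; simp
    have hd : Complex.polarCoord.symm (r, θ) ∈ disk ↔ r ≤ 1 := by
      rw [disk, mem_closedBall_zero_iff, Complex.norm_polarCoord_symm, abs_of_pos hr]
    by_cases h : r ≤ 1
    · rw [Set.indicator_of_mem (hd.2 h), Set.indicator_of_mem (by exact ⟨⟨hr, h⟩, trivial⟩), e]
    · rw [Set.indicator_of_notMem (mt hd.1 h), smul_zero,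
        Set.indicator_of_notMem (fun h' => h h'.1.2)]
  rw [setIntegral_congr_fun polarCoord.open_target.measurableSet e1, integral_indicator
    (measurableSet_Ioc.prod MeasurableSet.univ), Measure.restrict_restrict
    (measurableSet_Ioc.prod MeasurableSet.univ)]
  have e2 : (Set.Ioc (0 : ℝ) 1 ×ˢ Set.univ) ∩ polarCoord.target =
      Set.Ioc (0 : ℝ) 1 ×ˢ Set.Ioo (-Real.pi) Real.pi := by
    ext ⟨r, θ⟩
    simp only [polarCoord_target, Set.mem_inter_iff, Set.mem_prod, Set.mem_Ioc, Set.mem_Ioi,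
      Set.mem_univ, Set.mem_Ioo]
    tauto
  rw [e2, Measure.volume_eq_prod, ← setIntegral_prod_swap, setIntegral_prod,
    ← integral_Ioc_eq_integral_Ioo, intervalIntegral.integral_of_le hpi]
  · simp only [intervalIntegral.integral_of_le zero_le_one, Prod.swap_prod_mk]
  · refine IntegrableOn.mono_set (t := Set.Icc (-Real.pi) Real.pi ×ˢ Set.Icc 0 1) ?_
      (Set.prod_mono Set.Ioo_subset_Icc_self Set.Ioc_subset_Icc_self)
    exact (hcont.comp continuous_swap).continuousOn.integrableOn_compact
      (isCompact_Icc.prod isCompact_Icc)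

theorem hasDerivAt_radial {A : ℂ → ℂ} (hA : ContDiff ℝ 1 A) (r θ : ℝ) :
    HasDerivAt (fun r : ℝ => A (r * Complex.exp (θ * Complex.I)))
      (Real.cos θ * fderiv ℝ A (r * Complex.exp (θ * Complex.I)) 1 +
        Real.sin θ * fderiv ℝ A (r * Complex.exp (θ * Complex.I)) Complex.I) r := by
  have h1 : HasDerivAt (fun r : ℝ => (r : ℂ) * Complex.exp (θ * Complex.I))
      (1 * Complex.exp (θ * Complex.I)) r := (Complex.ofRealCLM.hasDerivAt (x := r)).mul_const _
  have h2 := ((hA.differentiable one_ne_zero) _).hasFDerivAt.comp_hasDerivAt r h1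
  convert! h2 using 1
  have e : 1 * Complex.exp (θ * Complex.I) =
      Real.cos θ • (1 : ℂ) + Real.sin θ • Complex.I := by
    rw [one_mul, Complex.exp_mul_I]; simp
  rw [e, map_add, map_smul, map_smul, Complex.real_smul, Complex.real_smul]

theorem hasDerivAt_angular {A : ℂ → ℂ} (hA : ContDiff ℝ 1 A) (r θ : ℝ) :
    HasDerivAt (fun θ : ℝ => A (r * Complex.exp (θ * Complex.I)))
      (r * (- Real.sin θ * fderiv ℝ A (r * Complex.exp (θ * Complex.I)) 1 +
        Real.cos θ * fderiv ℝ A (r * Complex.exp (θ * Complex.I)) Complex.I)) θ := by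
  have h1 : HasDerivAt (fun θ : ℝ => (r : ℂ) * Complex.exp (θ * Complex.I))
      (r * (Complex.exp (θ * Complex.I) * (1 * Complex.I))) θ :=
    (((Complex.ofRealCLM.hasDerivAt (x := θ)).mul_const Complex.I).cexp).const_mul (r : ℂ)
  have h2 := ((hA.differentiable one_ne_zero) _).hasFDerivAt.comp_hasDerivAt θ h1
  convert! h2 using 1
  have e : r * (Complex.exp (θ * Complex.I) * (1 * Complex.I)) =
      (r * -Real.sin θ) • (1 : ℂ) + (r * Real.cos θ) • Complex.I := by
    rw [one_mul, Complex.exp_mul_I]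
    simp only [Complex.real_smul, Complex.ofReal_mul, Complex.ofReal_neg, Complex.ofReal_sin,
      Complex.ofReal_cos]
    linear_combination (r : ℂ) * Complex.sin θ * Complex.I_mul_I
  rw [e, map_add, map_smul, map_smul, Complex.real_smul, Complex.real_smul]
  push_cast
  ring

/-- The divergence theorem on the rectangle `[0, 1] × [-π, π]` for a field `(f, g)` whose
component `g` takes the same values on the two sides `θ = -π` and `θ = π`. -/
theorem divergence_rect {f g f' g' : ℝ → ℝ → ℂ}
    (hf : ∀ r θ, HasDerivAt (fun r => f r θ) (f' r θ) r)
    (hg : ∀ r θ, HasDerivAt (fun θ => g r θ) (g' r θ) θ)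
    (cf : Continuous (Function.uncurry f')) (cg : Continuous (Function.uncurry g'))
    (per : ∀ r, g r Real.pi = g r (-Real.pi)) :
    ∫ θ in -Real.pi..Real.pi, ∫ r in (0 : ℝ)..1, (f' r θ + g' r θ) =
      ∫ θ in -Real.pi..Real.pi, (f 1 θ - f 0 θ) := by
  have cf2 : ∀ θ, Continuous fun r => f' r θ := fun θ =>
    cf.comp (continuous_id.prodMk continuous_const)
  have cg1 : ∀ r, Continuous fun θ => g' r θ := fun r =>
    cg.comp (continuous_const.prodMk continuous_id)
  have cg2 : ∀ θ, Continuous fun r => g' r θ := fun θ =>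
    cg.comp (continuous_id.prodMk continuous_const)
  have i1 : ∀ θ, ∫ r in (0 : ℝ)..1, f' r θ = f 1 θ - f 0 θ := fun θ =>
    intervalIntegral.integral_eq_sub_of_hasDerivAt (fun r _ => hf r θ)
      ((cf2 θ).intervalIntegrable _ _)
  have i2 : ∀ r, ∫ θ in -Real.pi..Real.pi, g' r θ = 0 := fun r => by
    rw [intervalIntegral.integral_eq_sub_of_hasDerivAt (fun θ _ => hg r θ)
      ((cg1 r).intervalIntegrable _ _), per, sub_self]
  have i3 : ∫ θ in -Real.pi..Real.pi, ∫ r in (0 : ℝ)..1, g' r θ = 0 := by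
    rw [← intervalIntegral_intervalIntegral_swap ((cg.continuousOn.integrableOn_compact
        (isCompact_uIcc.prod isCompact_uIcc)).mono_set
        (Set.prod_mono Set.uIoc_subset_uIcc Set.uIoc_subset_uIcc))]
    simp [i2]
  rw [intervalIntegral.integral_congr (g := fun θ => (∫ r in (0 : ℝ)..1, f' r θ) +
    ∫ r in (0 : ℝ)..1, g' r θ) fun θ _ => intervalIntegral.integral_add
      ((cf2 θ).intervalIntegrable _ _) ((cg2 θ).intervalIntegrable _ _),
    intervalIntegral.integral_add, i3, add_zero]
  · simp only [i1]
  · exact (intervalIntegral.continuous_parametric_intervalIntegral_of_continuous'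
      (f := fun θ r => f' r θ) (cf.comp continuous_swap) _ _).intervalIntegrable _ _
  · exact (intervalIntegral.continuous_parametric_intervalIntegral_of_continuous'
      (f := fun θ r => g' r θ) (cg.comp continuous_swap) _ _).intervalIntegrable _ _

/-- The divergence theorem for the field `(A, B)` on the disk, whose outer normal at `z` is `z`.
In polar coordinates `r (∂A/∂x + ∂B/∂y)` is the sum of the radial derivative of
`r (A cos θ + B sin θ)` and the angular derivative of `-A sin θ + B cos θ`. -/
theorem divergence_disk {A B : ℂ → ℂ} (hA : ContDiff ℝ 1 A) (hB : ContDiff ℝ 1 B) :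
    ∫ z, (fderiv ℝ A z 1 + fderiv ℝ B z Complex.I) ∂lebDisk =
      ∫ z, (A z * z.re + B z * z.im) ∂arcLength := by
  have cA := hA.continuous
  have cB := hB.continuous
  have dA : ∀ e, Continuous fun z => fderiv ℝ A z e := fun e =>
    (hA.continuous_fderiv one_ne_zero).clm_apply continuous_const
  have dB : ∀ e, Continuous fun z => fderiv ℝ B z e := fun e =>
    (hB.continuous_fderiv one_ne_zero).clm_apply continuous_const
  have dA1 := dA 1
  have dA2 := dA Complex.I
  have dB1 := dB 1
  have dB2 := dB Complex.I
  rw [lebDisk_polar (by fun_prop), integral_arcLength _ (by fun_prop)]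
  -- the radial and the angular component of the field, in polar coordinates
  set f : ℝ → ℝ → ℂ := fun r θ => r * (A (r * Complex.exp (θ * Complex.I)) * Real.cos θ +
    B (r * Complex.exp (θ * Complex.I)) * Real.sin θ) with hf
  set g : ℝ → ℝ → ℂ := fun r θ => A (r * Complex.exp (θ * Complex.I)) * -Real.sin θ +
    B (r * Complex.exp (θ * Complex.I)) * Real.cos θ with hg
  let P : ℝ → ℝ → ℂ := fun r θ => r * Complex.exp (θ * Complex.I)
  let f' : ℝ → ℝ → ℂ := fun r θ => 1 * (A (P r θ) * Real.cos θ + B (P r θ) * Real.sin θ) +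
    r * ((Real.cos θ * fderiv ℝ A (P r θ) 1 + Real.sin θ * fderiv ℝ A (P r θ) Complex.I) *
      Real.cos θ +
      (Real.cos θ * fderiv ℝ B (P r θ) 1 + Real.sin θ * fderiv ℝ B (P r θ) Complex.I) *
      Real.sin θ)
  let g' : ℝ → ℝ → ℂ := fun r θ =>
    ((r * (- Real.sin θ * fderiv ℝ A (P r θ) 1 + Real.cos θ * fderiv ℝ A (P r θ) Complex.I)) *
      -Real.sin θ + A (P r θ) * -Real.cos θ) +
    ((r * (- Real.sin θ * fderiv ℝ B (P r θ) 1 + Real.cos θ * fderiv ℝ B (P r θ) Complex.I)) *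
      Real.cos θ + B (P r θ) * -Real.sin θ)
  have cP : Continuous (Function.uncurry P) := by
    simp only [P, Function.uncurry_def]; fun_prop
  have hf' : ∀ θ r, HasDerivAt (fun r => f r θ) (f' r θ) r := fun θ r =>
    (Complex.ofRealCLM.hasDerivAt (x := r)).mul (((hasDerivAt_radial hA r θ).mul_const _).add
      ((hasDerivAt_radial hB r θ).mul_const _))
  have hg' : ∀ r θ, HasDerivAt (fun θ => g r θ) (g' r θ) θ := by
    intro r θ
    have s := (Real.hasDerivAt_sin θ).ofReal_comp
    have c := (Real.hasDerivAt_cos θ).ofReal_comp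
    rw [Complex.ofReal_neg] at c
    exact ((hasDerivAt_angular hA r θ).mul s.neg).add ((hasDerivAt_angular hB r θ).mul c)
  have cf' : Continuous (Function.uncurry f') := by
    simp only [f', Function.uncurry_def] at cP ⊢
    fun_prop
  have cg' : Continuous (Function.uncurry g') := by
    simp only [g', Function.uncurry_def] at cP ⊢
    fun_prop
  have e1 : ∀ θ r : ℝ, r • (fderiv ℝ A (r * Complex.exp (θ * Complex.I)) 1 +
      fderiv ℝ B (r * Complex.exp (θ * Complex.I)) Complex.I) = f' r θ + g' r θ := by
    intro θ r
    have h := Complex.cos_sq_add_sin_sq (θ : ℂ)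
    simp only [f', g', P, Complex.real_smul, Complex.ofReal_cos, Complex.ofReal_sin]
    linear_combination (-(r : ℂ) * (fderiv ℝ A (r * Complex.exp (θ * Complex.I)) 1 +
      fderiv ℝ B (r * Complex.exp (θ * Complex.I)) Complex.I)) * h
  have per : ∀ r, g r Real.pi = g r (-Real.pi) := by
    intro r
    have : Complex.exp (-(Real.pi * Complex.I)) = Complex.exp (Real.pi * Complex.I) := by
      rw [Complex.exp_neg, Complex.exp_pi_mul_I]; norm_num
    simp [hg, this]
  simp only [e1]
  rw [divergence_rect (fun r θ => hf' θ r) hg' cf' cg' per]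
  refine intervalIntegral.integral_congr fun θ _ => ?_
  simp only [hf, Complex.exp_ofReal_mul_I_re, Complex.exp_ofReal_mul_I_im]
  simp

/-! ### The Poincaré inequality on convex sets -/

/-- The squared length `|∂w/∂x|² + |∂w/∂y|²` of the gradient. -/
def gradSq (w : ℂ → ℂ) (z : ℂ) : ℝ :=
  ‖fderiv ℝ w z 1‖ ^ 2 + ‖fderiv ℝ w z Complex.I‖ ^ 2

theorem gradSq_nonneg (w : ℂ → ℂ) (z : ℂ) : 0 ≤ gradSq w z := by
  unfold gradSq; positivity

theorem continuous_gradSq {w : ℂ → ℂ} (hw : ContDiff ℝ 1 w) : Continuous (gradSq w) := by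
  have h : ∀ e, Continuous fun z => fderiv ℝ w z e := fun e =>
    (hw.continuous_fderiv one_ne_zero).clm_apply continuous_const
  exact ((h _).norm.pow 2).add ((h _).norm.pow 2)

theorem norm_fderiv_apply_sq_le (w : ℂ → ℂ) (z h : ℂ) :
    ‖fderiv ℝ w z h‖ ^ 2 ≤ ‖h‖ ^ 2 * gradSq w z := by
  have e : h = h.re • (1 : ℂ) + h.im • Complex.I := by simp
  have h1 : ‖fderiv ℝ w z h‖ ≤
      |h.re| * ‖fderiv ℝ w z 1‖ + |h.im| * ‖fderiv ℝ w z Complex.I‖ := by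
    conv_lhs => rw [e, map_add, map_smul, map_smul]
    refine (norm_add_le _ _).trans_eq ?_
    rw [norm_smul, norm_smul, Real.norm_eq_abs, Real.norm_eq_abs]
  have h2 : ‖h‖ ^ 2 = |h.re| ^ 2 + |h.im| ^ 2 := by
    rw [← Complex.normSq_eq_norm_sq, Complex.normSq_apply, sq_abs, sq_abs]; ring
  refine (pow_le_pow_left₀ (norm_nonneg _) h1 2).trans ?_
  rw [h2, gradSq]
  nlinarith [sq_nonneg (|h.re| * ‖fderiv ℝ w z Complex.I‖ - |h.im| * ‖fderiv ℝ w z 1‖)]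

theorem sq_intervalIntegral_le {f : ℝ → ℝ} (hf : Continuous f) :
    (∫ t in (0 : ℝ)..1, f t) ^ 2 ≤ ∫ t in (0 : ℝ)..1, f t ^ 2 := by
  -- expand the nonnegative variance `∫ (f - c)²` about the mean `c`
  set c := ∫ t in (0 : ℝ)..1, f t with hc
  have h : 0 ≤ ∫ t in (0 : ℝ)..1, (f t - c) ^ 2 :=
    intervalIntegral.integral_nonneg zero_le_one fun _ _ => sq_nonneg _
  have e : ∀ t, (f t - c) ^ 2 = f t ^ 2 - (2 * c) * f t + c ^ 2 := fun t => by ring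
  simp only [e] at h
  rw [intervalIntegral.integral_add, intervalIntegral.integral_sub,
    intervalIntegral.integral_const_mul, ← hc, intervalIntegral.integral_const] at h
  · simp only [sub_zero, one_smul] at h
    nlinarith
  all_goals exact Continuous.intervalIntegrable (by fun_prop) _ _

/-- The fundamental theorem of calculus and the Cauchy-Schwarz inequality along a segment. -/
theorem norm_sub_sq_le_integral {w : ℂ → ℂ} (hw : ContDiff ℝ 1 w) (x y : ℂ) :
    ‖w x - w y‖ ^ 2 ≤ ‖x - y‖ ^ 2 *
      ∫ t in (0 : ℝ)..1, gradSq w ((1 - t) • x + t • y) := by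
  have cp : Continuous fun t : ℝ => (1 - t) • x + t • y := by fun_prop
  have cd : Continuous fun t : ℝ => fderiv ℝ w ((1 - t) • x + t • y) (y - x) :=
    ((hw.continuous_fderiv one_ne_zero).comp cp).clm_apply continuous_const
  have hd : ∀ t : ℝ, HasDerivAt (fun t : ℝ => w ((1 - t) • x + t • y))
      (fderiv ℝ w ((1 - t) • x + t • y) (y - x)) t := by
    intro t
    refine (hw.differentiable one_ne_zero _).hasFDerivAt.comp_hasDerivAt t ?_
    convert! (((hasDerivAt_id t).const_sub 1).smul_const x).add
      ((hasDerivAt_id t).smul_const y) using 1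
    module
  have h1 : w y - w x = ∫ t in (0 : ℝ)..1, fderiv ℝ w ((1 - t) • x + t • y) (y - x) := by
    rw [intervalIntegral.integral_eq_sub_of_hasDerivAt (fun t _ => hd t)
      (cd.intervalIntegrable _ _)]
    simp
  calc ‖w x - w y‖ ^ 2
      ≤ (∫ t in (0 : ℝ)..1, ‖fderiv ℝ w ((1 - t) • x + t • y) (y - x)‖) ^ 2 := by
        rw [norm_sub_rev, h1]
        exact pow_le_pow_left₀ (norm_nonneg _)
          (intervalIntegral.norm_integral_le_integral_norm zero_le_one) 2
    _ ≤ ∫ t in (0 : ℝ)..1, ‖fderiv ℝ w ((1 - t) • x + t • y) (y - x)‖ ^ 2 :=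
        sq_intervalIntegral_le cd.norm
    _ ≤ ∫ t in (0 : ℝ)..1, ‖x - y‖ ^ 2 * gradSq w ((1 - t) • x + t • y) := by
        refine intervalIntegral.integral_mono_on zero_le_one
          ((cd.norm.pow 2).intervalIntegrable _ _)
          ((((continuous_gradSq hw).comp cp).const_mul _).intervalIntegrable _ _) fun t _ => ?_
        rw [norm_sub_rev x y]
        exact norm_fderiv_apply_sq_le _ _ _
    _ = _ := intervalIntegral.integral_const_mul _ _

/-- The map `y ↦ (1 - t) x + t y` sends a convex set containing `x` into itself and multiplies
areas by `t² ≥ 1/4`. -/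
theorem lintegral_segment_le {C : Set ℂ} (hC : Convex ℝ C) (hm : MeasurableSet C)
    {N : ℂ → ℝ≥0∞} (hN : Measurable N) {x : ℂ} (hx : x ∈ C) {t : ℝ} (ht : 1 / 2 ≤ t)
    (ht1 : t ≤ 1) :
    ∫⁻ y in C, N ((1 - t) • x + t • y) ≤ 4 * ∫⁻ z in C, N z := by
  have hF : Measurable (C.indicator N) := hN.indicator hm
  have ht0 : t ≠ 0 := by linarith
  calc ∫⁻ y in C, N ((1 - t) • x + t • y)
      = ∫⁻ y in C, C.indicator N ((1 - t) • x + t • y) := by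
        refine setLIntegral_congr_fun hm fun y hy => ?_
        exact (Set.indicator_of_mem (hC hx hy (by linarith) (by linarith) (by ring)) N).symm
    _ ≤ ∫⁻ y, C.indicator N ((1 - t) • x + t • y) := setLIntegral_le_lintegral _ _
    _ = ∫⁻ y, C.indicator N ((1 - t) • x + y) ∂(Measure.map (t • ·) volume) := by
        rw [lintegral_map (by fun_prop) (by fun_prop)]
    _ = ENNReal.ofReal |(t ^ 2)⁻¹| * ∫⁻ y, C.indicator N y := by
        rw [Measure.map_addHaar_smul _ ht0, lintegral_smul_measure,
          lintegral_add_left_eq_self, Complex.finrank_real_complex, smul_eq_mul]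
    _ ≤ 4 * ∫⁻ z in C, N z := by
        rw [lintegral_indicator hm]
        gcongr
        rw [show (4 : ℝ≥0∞) = ENNReal.ofReal 4 by norm_num]
        refine ENNReal.ofReal_le_ofReal ?_
        rw [abs_of_pos (by positivity), inv_le_comm₀ (by positivity) (by norm_num)]
        nlinarith

/-- The average of `N` over all segments with end points in a convex set `C` is at most four times
its average over `C`. -/
theorem lintegral_segments_le {C : Set ℂ} (hC : Convex ℝ C) (hm : MeasurableSet C)
    {N : ℂ → ℝ≥0∞} (hN : Measurable N) :
    ∫⁻ x in C, ∫⁻ y in C, ∫⁻ t in Set.Ioc (0 : ℝ) 1, N ((1 - t) • x + t • y) ≤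
      4 * volume C * ∫⁻ z in C, N z := by
  have key : ∀ t ∈ Set.Ioc (0 : ℝ) 1,
      ∫⁻ x in C, ∫⁻ y in C, N ((1 - t) • x + t • y) ≤ 4 * volume C * ∫⁻ z in C, N z := by
    have aux : ∀ t : ℝ, 1 / 2 ≤ t → t ≤ 1 →
        ∫⁻ x in C, ∫⁻ y in C, N ((1 - t) • x + t • y) ≤ 4 * volume C * ∫⁻ z in C, N z := by
      intro t h1 h2
      calc _ ≤ ∫⁻ x in C, 4 * ∫⁻ z in C, N z :=
            setLIntegral_mono' hm fun x hx => lintegral_segment_le hC hm hN hx h1 h2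
        _ = _ := by rw [setLIntegral_const]; ring
    intro t ht
    rcases le_total (1 / 2) t with h | h
    · exact aux t h ht.2
    · -- for `t ≤ 1/2` the roles of `x` and `y` are exchanged
      rw [lintegral_lintegral_swap (by fun_prop)]
      have := aux (1 - t) (by linarith) (by linarith [ht.1])
      simpa only [sub_sub_cancel, add_comm] using this
  have hswap : ∫⁻ x in C, ∫⁻ y in C, ∫⁻ t in Set.Ioc (0 : ℝ) 1, N ((1 - t) • x + t • y) =
      ∫⁻ t in Set.Ioc (0 : ℝ) 1, ∫⁻ x in C, ∫⁻ y in C, N ((1 - t) • x + t • y) := by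
    have h1 : ∀ x : ℂ, ∫⁻ y in C, ∫⁻ t in Set.Ioc (0 : ℝ) 1, N ((1 - t) • x + t • y) =
        ∫⁻ t in Set.Ioc (0 : ℝ) 1, ∫⁻ y in C, N ((1 - t) • x + t • y) := fun x =>
      lintegral_lintegral_swap (by fun_prop)
    simp only [h1]
    refine lintegral_lintegral_swap (f := fun x (t : ℝ) => ∫⁻ y in C, N ((1 - t) • x + t • y)) ?_
    have : Measurable fun p : (ℂ × ℝ) × ℂ => N ((1 - p.1.2) • p.1.1 + p.1.2 • p.2) := by fun_prop
    exact this.lintegral_prod_right'.aemeasurable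
  rw [hswap]
  calc _ ≤ ∫⁻ t in Set.Ioc (0 : ℝ) 1, 4 * volume C * ∫⁻ z in C, N z :=
        setLIntegral_mono' measurableSet_Ioc key
    _ = _ := by rw [setLIntegral_const]; simp

theorem integrableOn_of_subset_disk {E : Type*} [NormedAddCommGroup E] {C : Set ℂ} (h : C ⊆ disk)
    {f : ℂ → E} (hf : Continuous f) : IntegrableOn f C :=
  (hf.continuousOn.integrableOn_compact (isCompact_closedBall 0 1)).mono_set h

/-- The variance identity `∬ |w(x) - w(y)|² = 2 |C| ∫ |w|² - 2 |∫ w|²`, for the inner integral. -/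
theorem integral_norm_sub_sq {C : Set ℂ} (h : C ⊆ disk) {w : ℂ → ℂ} (hw : Continuous w) (x : ℂ) :
    ∫ y in C, ‖w x - w y‖ ^ 2 = volume.real C * ‖w x‖ ^ 2 - 2 * inner ℝ (w x) (∫ y in C, w y) +
      ∫ y in C, ‖w y‖ ^ 2 := by
  have i1 := integrableOn_of_subset_disk h hw
  have i2 : IntegrableOn (fun y => ‖w y‖ ^ 2) C :=
    integrableOn_of_subset_disk h (by fun_prop)
  have hfin : IsFiniteMeasure (volume.restrict C) :=
    ⟨by rw [Measure.restrict_apply_univ]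
        exact (measure_mono h).trans_lt (isCompact_closedBall (0 : ℂ) 1).measure_lt_top⟩
  simp only [norm_sub_sq_real]
  rw [integral_add _ i2, integral_sub (integrable_const _), integral_const_mul,
    integral_inner i1]
  · simp
  · exact (i1.const_inner (w x)).const_mul 2
  · exact (integrable_const _).sub ((i1.const_inner (w x)).const_mul 2)

/-- The Poincaré inequality on a convex set `C` of diameter at most `d`, with explicit constants.
The variance of `w` is half the mean of `|w(x) - w(y)|²`, and each difference is bounded by an
integral of the gradient along the segment from `x` to `y`. If `C` is a null set, the junk value
`0⁻¹ = 0` is harmless, since both integrals over `C` vanish. -/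
theorem poincare_convex {C : Set ℂ} (hC : Convex ℝ C) (hm : MeasurableSet C) (h : C ⊆ disk)
    {d : ℝ} (hd : ∀ x ∈ C, ∀ y ∈ C, ‖x - y‖ ≤ d) {w : ℂ → ℂ} (hw : ContDiff ℝ 1 w) :
    ∫ z in C, ‖w z‖ ^ 2 ≤
      (volume.real C)⁻¹ * ‖∫ z in C, w z‖ ^ 2 + 2 * d ^ 2 * ∫ z in C, gradSq w z := by
  have cw := hw.continuous
  have cg := continuous_gradSq hw
  have i1 := integrableOn_of_subset_disk h cw
  have i2 : IntegrableOn (fun y => ‖w y‖ ^ 2) C :=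
    integrableOn_of_subset_disk h (by fun_prop)
  have hfinC : volume C < ⊤ :=
    (measure_mono h).trans_lt (isCompact_closedBall (0 : ℂ) 1).measure_lt_top
  have hfin : IsFiniteMeasure (volume.restrict C) :=
    ⟨by rwa [Measure.restrict_apply_univ]⟩
  rcases eq_or_ne (volume C) 0 with h0 | h0
  · simp [Measure.restrict_eq_zero.2 h0]
  have hpos : 0 < volume.real C := ENNReal.toReal_pos h0 hfinC.ne
  have hG : 0 ≤ ∫ z in C, gradSq w z := integral_nonneg fun _ => gradSq_nonneg _ _
  have cx : Continuous fun x => ∫ y in C, ‖w x - w y‖ ^ 2 := by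
    simp only [integral_norm_sub_sq h cw]; fun_prop
  -- the variance identity
  have e1 : ∫ x in C, ∫ y in C, ‖w x - w y‖ ^ 2 =
      2 * (volume.real C * ∫ z in C, ‖w z‖ ^ 2) - 2 * ‖∫ z in C, w z‖ ^ 2 := by
    simp only [integral_norm_sub_sq h cw]
    have i3 : IntegrableOn (fun x => inner ℝ (w x) (∫ y in C, w y)) C := by
      exact integrableOn_of_subset_disk h (by fun_prop)
    rw [integral_add (by exact (i2.const_mul _).sub (i3.const_mul 2)) (integrable_const _),
      integral_sub (i2.const_mul _) (i3.const_mul 2), integral_const_mul, integral_const_mul]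
    simp only [real_inner_comm (∫ y in C, w y)]
    rw [integral_inner i1, real_inner_self_eq_norm_sq]
    simp only [integral_const, MeasurableSet.univ, measureReal_restrict_apply, Set.univ_inter,
      smul_eq_mul]
    ring
  -- the bound by the gradient, in `ℝ≥0∞` so that no integrability is needed to exchange integrals
  have e2 : ENNReal.ofReal (∫ x in C, ∫ y in C, ‖w x - w y‖ ^ 2) ≤
      ENNReal.ofReal (d ^ 2 * (4 * volume.real C * ∫ z in C, gradSq w z)) := by
    rw [ofReal_integral_eq_lintegral_ofReal (integrableOn_of_subset_disk h cx)
      (ae_of_all _ fun x => integral_nonneg fun y => by positivity)]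
    calc _ = ∫⁻ x in C, ∫⁻ y in C, ENNReal.ofReal (‖w x - w y‖ ^ 2) := by
          refine lintegral_congr fun x => ofReal_integral_eq_lintegral_ofReal
            (integrableOn_of_subset_disk h (by fun_prop)) (ae_of_all _ fun y => by positivity)
      _ ≤ ∫⁻ x in C, ∫⁻ y in C, ENNReal.ofReal (d ^ 2) *
          ∫⁻ t in Set.Ioc (0 : ℝ) 1, ENNReal.ofReal (gradSq w ((1 - t) • x + t • y)) := by
          refine setLIntegral_mono' hm fun x hx => setLIntegral_mono' hm fun y hy => ?_
          have cc : Continuous fun t : ℝ => gradSq w ((1 - t) • x + t • y) :=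
            cg.comp (by fun_prop)
          rw [← ofReal_integral_eq_lintegral_ofReal (cc.integrableOn_Ioc)
            (ae_of_all _ fun t => gradSq_nonneg _ _), ← ENNReal.ofReal_mul (by positivity),
            ← intervalIntegral.integral_of_le zero_le_one]
          refine ENNReal.ofReal_le_ofReal ((norm_sub_sq_le_integral hw x y).trans ?_)
          gcongr
          · exact intervalIntegral.integral_nonneg zero_le_one fun _ _ => gradSq_nonneg _ _
          · exact hd x hx y hy
      _ = ENNReal.ofReal (d ^ 2) * ∫⁻ x in C, ∫⁻ y in C,
          ∫⁻ t in Set.Ioc (0 : ℝ) 1, ENNReal.ofReal (gradSq w ((1 - t) • x + t • y)) := by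
          simp only [lintegral_const_mul' _ _ ENNReal.ofReal_ne_top]
      _ ≤ ENNReal.ofReal (d ^ 2) *
          (4 * volume C * ∫⁻ z in C, ENNReal.ofReal (gradSq w z)) := by
          gcongr
          exact lintegral_segments_le hC hm (by fun_prop)
      _ = _ := by
          rw [ENNReal.ofReal_mul (by positivity), ENNReal.ofReal_mul (by positivity),
            ENNReal.ofReal_mul (by norm_num), ofReal_integral_eq_lintegral_ofReal
            (integrableOn_of_subset_disk h cg) (ae_of_all _ fun _ => gradSq_nonneg _ _),
            Measure.real, ENNReal.ofReal_toReal hfinC.ne]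
          norm_num
  rw [ENNReal.ofReal_le_ofReal_iff (by positivity), e1] at e2
  refine le_of_mul_le_mul_left ?_ hpos
  rw [mul_add, mul_inv_cancel_left₀ hpos.ne']
  linarith

/-! ### Polynomials in `z` and `z̄` are total in `L²(𝔻)` -/

instance : CompactSpace disk := isCompact_iff_compactSpace.1 (isCompact_closedBall (0 : ℂ) 1)

/-- The coordinate function `z` on the disk. -/
def diskCoord : C(disk, ℂ) := ⟨Subtype.val, continuous_subtype_val⟩

/-- Stone-Weierstrass: the monomials `zᵃ z̄ᵇ` span a dense subspace of `C(𝔻)`. -/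
theorem closure_span_monomials :
    (Submodule.span ℂ (Set.range fun n : ℕ × ℕ =>
      diskCoord ^ n.1 * star diskCoord ^ n.2)).topologicalClosure = ⊤ := by
  set S := Submodule.span ℂ (Set.range fun n : ℕ × ℕ =>
      diskCoord ^ n.1 * star diskCoord ^ n.2)
  -- the star subalgebra generated by `z` is the algebra generated by `z` and `z̄`
  let R : Subalgebra ℂ C(disk, ℂ) := Algebra.adjoin ℂ {diskCoord, star diskCoord}
  have hR : ∀ p ∈ R, p ∈ S := by
    intro p hp
    have h : p ∈ Subalgebra.toSubmodule R := hp
    rw [Algebra.adjoin_eq_span] at h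
    refine Submodule.span_mono ?_ h
    rintro q hq
    obtain ⟨a, b, rfl⟩ := (Submonoid.mem_closure_pair _ _ _).1 hq
    exact ⟨(a, b), rfl⟩
  have hx : diskCoord ∈ R := Algebra.subset_adjoin (by simp)
  have hy : star diskCoord ∈ R := Algebra.subset_adjoin (by simp)
  let A : StarSubalgebra ℂ C(disk, ℂ) := StarAlgebra.adjoin ℂ {diskCoord}
  have hA : ∀ p ∈ A, p ∈ R ∧ star p ∈ R := by
    intro p hp
    induction hp using StarAlgebra.adjoin_induction with
    | mem x h =>
      rw [Set.mem_singleton_iff] at h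
      subst h
      exact ⟨hx, hy⟩
    | algebraMap r =>
      refine ⟨R.algebraMap_mem r, ?_⟩
      rw [← algebraMap_star_comm]
      exact R.algebraMap_mem _
    | add x y _ _ h1 h2 => rw [star_add]; exact ⟨R.add_mem h1.1 h2.1, R.add_mem h1.2 h2.2⟩
    | mul x y _ _ h1 h2 => rw [star_mul]; exact ⟨R.mul_mem h1.1 h2.1, R.mul_mem h2.2 h1.2⟩
    | star x _ h => rw [star_star]; exact h.symm
  have htop : A.topologicalClosure = ⊤ := by
    refine ContinuousMap.starSubalgebra_topologicalClosure_eq_top_of_separatesPoints A ?_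
    intro x y hxy
    exact ⟨_, ⟨diskCoord, StarAlgebra.self_mem_adjoin_singleton ℂ _, rfl⟩,
      fun h => hxy (Subtype.ext h)⟩
  rw [eq_top_iff]
  intro p _
  have hp : p ∈ A.topologicalClosure := by rw [htop]; trivial
  exact closure_mono (fun q hq => hR q (hA q hq).1) hp

/-- A function on the disk all of whose moments against `zᵃ z̄ᵇ` vanish is zero almost everywhere:
by density it is orthogonal to all continuous functions. -/
theorem ae_eq_zero_of_moments {f : ℂ → ℂ} (hf : Integrable f lebDisk)
    (h : ∀ a b : ℕ, ∫ z, f z * (z ^ a * (starRingEnd ℂ) z ^ b) ∂lebDisk = 0) :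
    f =ᵐ[lebDisk] 0 := by
  let ν : Measure disk := volume.comap Subtype.val
  have hfν : Integrable (fun z : disk => f z) ν := by
    rw [lebDisk, ← map_comap_subtype_coe disk_measurable] at hf
    exact (MeasurableEmbedding.subtype_coe disk_measurable).integrable_map_iff.1 hf
  have conv : ∀ φ : ℂ → ℂ, ∫ z : disk, f z * φ z ∂ν = ∫ z, f z * φ z ∂lebDisk := fun φ =>
    integral_subtype_comap disk_measurable fun z => f z * φ z
  have hint : ∀ p : C(disk, ℂ), Integrable (fun z : disk => f z * p z) ν := fun p =>
    hfν.mul_bdd (c := ‖p‖) p.continuous.aestronglyMeasurable (ae_of_all _ p.norm_coe_le_norm)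
  -- integration against `f` is a continuous functional on `C(𝔻)`
  let Λ : C(disk, ℂ) →L[ℂ] ℂ := LinearMap.mkContinuous
    { toFun := fun p => ∫ z : disk, f z * p z ∂ν
      map_add' := fun p q => by
        simp only [ContinuousMap.add_apply, mul_add]
        exact integral_add (hint p) (hint q)
      map_smul' := fun c p => by
        simp only [ContinuousMap.smul_apply, smul_eq_mul, mul_left_comm _ c, RingHom.id_apply]
        exact integral_const_mul _ _ } (∫ z : disk, ‖f z‖ ∂ν) fun p => by
      rw [← integral_mul_const]
      refine norm_integral_le_of_norm_le (hfν.norm.mul_const _) (ae_of_all _ fun z => ?_)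
      rw [norm_mul]
      exact mul_le_mul_of_nonneg_left (p.norm_coe_le_norm z) (norm_nonneg _)
  have hΛ : ∀ p, Λ p = 0 := by
    have h1 : Submodule.span ℂ (Set.range fun n : ℕ × ℕ =>
        diskCoord ^ n.1 * star diskCoord ^ n.2) ≤ Λ.ker := by
      rw [Submodule.span_le]
      rintro _ ⟨⟨a, b⟩, rfl⟩
      exact (conv fun z => z ^ a * (starRingEnd ℂ) z ^ b).trans (h a b)
    have h2 := Submodule.topologicalClosure_minimal _ h1 Λ.isClosed_ker
    rw [closure_span_monomials] at h2
    exact fun p => h2 trivial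
  have hloc : LocallyIntegrable (disk.indicator f) volume :=
    ((integrable_indicator_iff disk_measurable).2 hf).locallyIntegrable
  have key := ae_eq_zero_of_integral_contDiff_smul_eq_zero hloc fun ψ hψ _ => by
    have e := (conv fun z => (ψ z : ℂ)).symm.trans
      (hΛ ⟨fun z => (ψ z : ℂ), by have := hψ.continuous; fun_prop⟩)
    rw [← e, lebDisk, ← integral_indicator disk_measurable]
    refine integral_congr_ae (ae_of_all _ fun z => ?_)
    by_cases hz : z ∈ disk
    · simp only [Set.indicator_of_mem hz, Complex.real_smul, mul_comm]
    · simp [Set.indicator_of_notMem hz]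
  rw [lebDisk, EventuallyEq, ae_restrict_iff' disk_measurable]
  filter_upwards [key] with z h1 h2
  rwa [Set.indicator_of_mem h2] at h1

/-! ### The measures on the circle and on the disk -/

instance : IsFiniteMeasure arcLength := by
  unfold arcLength; infer_instance

theorem ae_lebDisk_mem : ∀ᵐ z ∂lebDisk, z ∈ disk := ae_restrict_mem disk_measurable

theorem ae_arcLength {p : ℂ → Prop} (hp : MeasurableSet {z | p z})
    (h : ∀ θ : ℝ, p (Complex.exp (θ * Complex.I))) : ∀ᵐ z ∂arcLength, p z := by
  rw [arcLength, ae_map_iff (by fun_prop) hp]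
  exact ae_of_all _ h

theorem ae_arcLength_norm : ∀ᵐ z ∂arcLength, ‖z‖ = 1 :=
  ae_arcLength (measurableSet_eq_fun measurable_norm measurable_const) fun θ =>
    Complex.norm_exp_ofReal_mul_I θ

theorem ae_arcLength_mem : ∀ᵐ z ∂arcLength, z ∈ disk :=
  ae_arcLength_norm.mono fun z hz => by rw [disk, mem_closedBall_zero_iff]; exact hz.le

theorem fsDisk_le : fsDisk ≤ lebDisk := by
  have h : fsDisk ≤ lebDisk.withDensity 1 := by
    refine withDensity_mono (ae_of_all _ fun z => ?_)
    refine ENNReal.ofReal_le_one.2 ?_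
    rw [div_le_one (by positivity)]
    exact one_le_pow₀ (by nlinarith [sq_nonneg ‖z‖])
  rwa [withDensity_one] at h

instance : IsFiniteMeasure fsDisk := isFiniteMeasure_of_le _ fsDisk_le

theorem ae_fsDisk_mem : ∀ᵐ z ∂fsDisk, z ∈ disk :=
  fsDisk_le.absolutelyContinuous.ae_le ae_lebDisk_mem

/-- Inversion restricts to the reflection `θ ↦ -θ` of the circle, which preserves arc length. -/
theorem measurePreserving_inversion :
    MeasurePreserving (fun z : ℂ => 1 / z) arcLength arcLength := by
  refine ⟨by fun_prop, ?_⟩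
  have e : (fun z : ℂ => 1 / z) ∘ (fun θ : ℝ => Complex.exp (θ * Complex.I)) =
      (fun θ : ℝ => Complex.exp (θ * Complex.I)) ∘ Neg.neg := by
    funext θ
    simp [Complex.exp_neg]
  have m : MeasurePreserving (Neg.neg : ℝ → ℝ) (volume.restrict (Set.Ioc (-Real.pi) Real.pi))
      (volume.restrict (Set.Ioc (-Real.pi) Real.pi)) := by
    rw [← Measure.restrict_congr_set Ioo_ae_eq_Ioc]
    have := (Measure.measurePreserving_neg (volume : Measure ℝ)).restrict_preimage
      (s := Set.Ioo (-Real.pi) Real.pi) measurableSet_Ioo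
    simpa using this
  rw [arcLength, Measure.map_map (by fun_prop) (by fun_prop), e,
    ← Measure.map_map (by fun_prop) (by fun_prop), m.map_eq]

theorem measurableEmbedding_inversion : MeasurableEmbedding (fun z : ℂ => 1 / z) :=
  MeasurableEquiv.measurableEmbedding
    ⟨⟨fun z : ℂ => 1 / z, fun z => 1 / z, fun z => by simp, fun z => by simp⟩,
      measurable_const.div measurable_id, measurable_const.div measurable_id⟩

theorem integral_inversion {E : Type*} [NormedAddCommGroup E] [NormedSpace ℝ E] (f : ℂ → E) :
    ∫ z, f (1 / z) ∂arcLength = ∫ z, f z ∂arcLength :=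
  measurePreserving_inversion.integral_comp measurableEmbedding_inversion f

/-! ### Functions which are smooth up to the boundary -/

/-- The space of smooth functions on the plane; their restrictions to the disk are the functions
that are smooth up to the boundary. -/
def smoothFun : Submodule ℂ (ℂ → ℂ) where
  carrier := {w | ContDiff ℝ ∞ w}
  add_mem' {u v} (h : ContDiff ℝ ∞ u) (k : ContDiff ℝ ∞ v) := by exact h.add k
  zero_mem' := show ContDiff ℝ ∞ fun _ : ℂ => (0 : ℂ) from contDiff_const
  smul_mem' c u (h : ContDiff ℝ ∞ u) := by exact h.const_smul c

theorem contDiff_smoothFun (w : smoothFun) : ContDiff ℝ ∞ (w : ℂ → ℂ) := by exact w.2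

theorem contDiff_fderiv_apply {w : ℂ → ℂ} (hw : ContDiff ℝ ∞ w) (e : ℂ) :
    ContDiff ℝ ∞ fun z => fderiv ℝ w z e :=
  (hw.fderiv_right (m := ∞) (by simp)).clm_apply contDiff_const

/-- The derivative in the direction `e`. -/
def partialDeriv (e : ℂ) : smoothFun →ₗ[ℂ] smoothFun where
  toFun w := ⟨fun z => fderiv ℝ (w : ℂ → ℂ) z e, by exact contDiff_fderiv_apply w.2 e⟩
  map_add' u v := by
    ext z
    have hu : DifferentiableAt ℝ (u : ℂ → ℂ) z := (contDiff_smoothFun u).differentiable (by simp) z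
    have hv : DifferentiableAt ℝ (v : ℂ → ℂ) z := (contDiff_smoothFun v).differentiable (by simp) z
    simp [fderiv_add hu hv]
  map_smul' c u := by
    ext z
    have hu : DifferentiableAt ℝ (u : ℂ → ℂ) z := (contDiff_smoothFun u).differentiable (by simp) z
    simp [fderiv_const_smul hu]

theorem integrable_of_continuous {m : Measure ℂ} [IsFiniteMeasure m] (hm : ∀ᵐ z ∂m, z ∈ disk)
    {E : Type*} [NormedAddCommGroup E] {w : ℂ → E} (hw : Continuous w)
    [SecondCountableTopologyEither ℂ E] : Integrable w m := by
  obtain ⟨C, hC⟩ := (isCompact_closedBall (0 : ℂ) 1).exists_bound_of_continuousOn hw.continuousOn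
  exact Integrable.of_bound hw.aestronglyMeasurable C (hm.mono hC)

theorem memLp_of_continuous {m : Measure ℂ} [IsFiniteMeasure m] (hm : ∀ᵐ z ∂m, z ∈ disk)
    {w : ℂ → ℂ} (hw : Continuous w) : MemLp w 2 m := by
  obtain ⟨C, hC⟩ := (isCompact_closedBall (0 : ℂ) 1).exists_bound_of_continuousOn hw.continuousOn
  exact MemLp.of_bound hw.aestronglyMeasurable C (hm.mono hC)

theorem continuous_smoothFun (w : smoothFun) : Continuous (w : ℂ → ℂ) :=
  (contDiff_smoothFun w).continuous

/-- The class in `L²(m)` of a smooth function, for a finite measure `m` carried by the disk. -/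
def toL2 {m : Measure ℂ} [IsFiniteMeasure m] (hm : ∀ᵐ z ∂m, z ∈ disk) :
    smoothFun →ₗ[ℂ] Lp ℂ 2 m where
  toFun w := (memLp_of_continuous hm (continuous_smoothFun w)).toLp w
  map_add' _ _ := MemLp.toLp_add _ _
  map_smul' _ _ := MemLp.toLp_const_smul _ _

theorem coeFn_toL2 {m : Measure ℂ} [IsFiniteMeasure m] (hm : ∀ᵐ z ∂m, z ∈ disk)
    (w : smoothFun) : toL2 hm w =ᵐ[m] (w : ℂ → ℂ) :=
  MemLp.coeFn_toLp (memLp_of_continuous hm (continuous_smoothFun w))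

theorem inner_toL2 {m : Measure ℂ} [IsFiniteMeasure m] (hm : ∀ᵐ z ∂m, z ∈ disk)
    (f : Lp ℂ 2 m) (w : smoothFun) :
    inner ℂ f (toL2 hm w) = ∫ z, (w : ℂ → ℂ) z * (starRingEnd ℂ) (f z) ∂m := by
  rw [L2.inner_def]
  refine integral_congr_ae ((coeFn_toL2 hm w).mono fun z hz => ?_)
  simp only [hz, RCLike.inner_apply]

theorem norm_sq_toL2 {m : Measure ℂ} [IsFiniteMeasure m] (hm : ∀ᵐ z ∂m, z ∈ disk)
    (w : smoothFun) : ‖toL2 hm w‖ ^ 2 = ∫ z, ‖(w : ℂ → ℂ) z‖ ^ 2 ∂m := by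
  have h := inner_toL2 hm (toL2 hm w) w
  rw [inner_self_eq_norm_sq_to_K] at h
  have e : ∫ z, (w : ℂ → ℂ) z * (starRingEnd ℂ) (toL2 hm w z) ∂m =
      ∫ z, ((‖(w : ℂ → ℂ) z‖ ^ 2 : ℝ) : ℂ) ∂m := by
    refine integral_congr_ae ((coeFn_toL2 hm w).mono fun z hz => ?_)
    simp only [hz]
    rw [Complex.mul_conj, Complex.normSq_eq_norm_sq]
  rw [e, integral_complex_ofReal] at h
  exact Complex.ofReal_injective (by simpa using h)

/-! ### Consequences of the divergence theorem -/

theorem hasFDerivAt_smooth {w : ℂ → ℂ} (hw : ContDiff ℝ ∞ w) (z : ℂ) :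
    HasFDerivAt w (fderiv ℝ w z) z := (hw.differentiable (by simp) z).hasFDerivAt

theorem fderiv_mul_apply {a b : ℂ → ℂ} (ha : ContDiff ℝ ∞ a) (hb : ContDiff ℝ ∞ b) (z e : ℂ) :
    fderiv ℝ (fun z => a z * b z) z e = a z * fderiv ℝ b z e + fderiv ℝ a z e * b z := by
  rw [((hasFDerivAt_smooth ha z).fun_mul (hasFDerivAt_smooth hb z)).fderiv]
  simp [mul_comm]

theorem contDiff_conj {n : ℕ∞ω} {w : ℂ → ℂ} (hw : ContDiff ℝ n w) :
    ContDiff ℝ n fun z => (starRingEnd ℂ) (w z) := Complex.conjCLE.contDiff.comp hw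

theorem fderiv_conj_apply {w : ℂ → ℂ} (hw : ContDiff ℝ ∞ w) (z e : ℂ) :
    fderiv ℝ (fun z => (starRingEnd ℂ) (w z)) z e = (starRingEnd ℂ) (fderiv ℝ w z e) := by
  have h : HasFDerivAt (fun z => (starRingEnd ℂ) (w z))
      ((Complex.conjCLE : ℂ →L[ℝ] ℂ).comp (fderiv ℝ w z)) z :=
    (Complex.conjCLE : ℂ →L[ℝ] ℂ).hasFDerivAt.comp z (hasFDerivAt_smooth hw z)
  rw [h.fderiv]
  rfl

/-- Green's formula `∫ (w ∂̄φ + φ ∂̄w) = (1/2i) ∮ w φ dz`, multiplied by `2`. -/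
theorem green_disk {w φ : ℂ → ℂ} (hw : ContDiff ℝ ∞ w) (hφ : ContDiff ℝ ∞ φ) :
    ∫ z, (w z * (fderiv ℝ φ z 1 + Complex.I * fderiv ℝ φ z Complex.I) +
      (fderiv ℝ w z 1 + Complex.I * fderiv ℝ w z Complex.I) * φ z) ∂lebDisk =
      ∫ z, w z * (z * φ z) ∂arcLength := by
  have h1 : ContDiff ℝ ∞ fun z => w z * φ z := hw.mul hφ
  have h2 : ContDiff ℝ ∞ fun z => Complex.I * (w z * φ z) := contDiff_const.mul h1
  have h := divergence_disk (h1.of_le (by simp)) (h2.of_le (by simp))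
  refine Eq.trans (integral_congr_ae (ae_of_all _ fun z => ?_))
    (h.trans (integral_congr_ae (ae_of_all _ fun z => ?_)))
  · simp only [fderiv_mul_apply contDiff_const h1, fderiv_mul_apply hw hφ, fderiv_fun_const,
      Pi.zero_apply, _root_.zero_apply]
    ring
  · simp only
    have e := Complex.re_add_im z
    linear_combination (w z * φ z) * e

/-- Smooth functions are weakly differentiable, with the expected derivatives. -/
theorem isWeakDeriv_smooth {w : ℂ → ℂ} (hw : ContDiff ℝ ∞ w) :
    IsWeakDeriv 1 w (fun z => fderiv ℝ w z 1) ∧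
    IsWeakDeriv Complex.I w (fun z => fderiv ℝ w z Complex.I) := by
  have bd : ∀ φ : ℂ → ℂ, tsupport φ ⊆ Metric.ball 0 1 → ∀ᵐ z ∂arcLength, φ z = 0 := by
    intro φ h
    filter_upwards [ae_arcLength_norm] with z hz
    by_contra hne
    have := h (subset_tsupport _ hne)
    rw [mem_ball_zero_iff] at this
    exact this.ne hz
  have key : ∀ e : ℂ, ∀ φ : ℂ → ℂ, ContDiff ℝ ∞ φ →
      ∫ z, fderiv ℝ (fun z => w z * φ z) z e ∂lebDisk = 0 →
      ∫ z, w z * fderiv ℝ φ z e ∂lebDisk = - ∫ z, fderiv ℝ w z e * φ z ∂lebDisk := by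
    intro e φ hφ h
    have c1 := continuous_fderiv_apply hφ e
    have c2 := continuous_fderiv_apply hw e
    have c3 := hw.continuous
    have c4 := hφ.continuous
    simp only [fderiv_mul_apply hw hφ] at h
    rw [integral_add] at h
    · exact eq_neg_of_add_eq_zero_left h
    all_goals exact integrable_of_continuous ae_lebDisk_mem (by fun_prop)
  constructor
  · intro φ h1 _ h3
    refine key _ φ h1 ?_
    have h := divergence_disk (A := fun z => w z * φ z) (B := fun _ => 0)
      ((hw.mul h1).of_le (by simp)) contDiff_const
    simp only [fderiv_fun_const, Pi.zero_apply, _root_.zero_apply, add_zero] at h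
    rw [h]
    exact integral_eq_zero_of_ae ((bd φ h3).mono fun z hz => by simp [hz])
  · intro φ h1 _ h3
    refine key _ φ h1 ?_
    have h := divergence_disk (A := fun _ => 0) (B := fun z => w z * φ z)
      contDiff_const ((hw.mul h1).of_le (by simp))
    simp only [fderiv_fun_const, Pi.zero_apply, _root_.zero_apply, zero_add] at h
    rw [h]
    exact integral_eq_zero_of_ae ((bd φ h3).mono fun z hz => by simp [hz])

/-- The trace inequality, from the divergence theorem for the field `|w|² (x, y)`. -/
theorem trace_inequality {w : ℂ → ℂ} (hw : ContDiff ℝ ∞ w) :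
    ∫ z, ‖w z‖ ^ 2 ∂arcLength ≤ 3 * (∫ z, ‖w z‖ ^ 2 ∂lebDisk) + ∫ z, gradSq w z ∂lebDisk := by
  have cw := hw.continuous
  have cg := continuous_gradSq (hw.of_le (by simp))
  have hc : ContDiff ℝ ∞ fun z => (starRingEnd ℂ) (w z) := contDiff_conj hw
  have hs : ContDiff ℝ ∞ fun z => w z * (starRingEnd ℂ) (w z) := hw.mul hc
  have hre : ContDiff ℝ ∞ fun z : ℂ => (z.re : ℂ) :=
    Complex.ofRealCLM.contDiff.comp Complex.reCLM.contDiff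
  have him : ContDiff ℝ ∞ fun z : ℂ => (z.im : ℂ) :=
    Complex.ofRealCLM.contDiff.comp Complex.imCLM.contDiff
  have dre : ∀ z e : ℂ, fderiv ℝ (fun z : ℂ => (z.re : ℂ)) z e = e.re := fun z e => by
    have := (Complex.ofRealCLM.comp Complex.reCLM).hasFDerivAt (x := z)
    exact congrArg (fun L => L e) this.fderiv
  have dim : ∀ z e : ℂ, fderiv ℝ (fun z : ℂ => (z.im : ℂ)) z e = e.im := fun z e => by
    have := (Complex.ofRealCLM.comp Complex.imCLM).hasFDerivAt (x := z)
    exact congrArg (fun L => L e) this.fderiv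
  have h := divergence_disk ((hs.mul hre).of_le (by simp)) ((hs.mul him).of_le (by simp))
  simp only [fderiv_mul_apply hs hre, fderiv_mul_apply hs him, dre, dim, fderiv_mul_apply hw hc,
    fderiv_conj_apply hw] at h
  -- on the circle the outer component of the field is `|w|²`
  have e1 : ∫ z, (w z * (starRingEnd ℂ) (w z) * z.re * z.re +
      w z * (starRingEnd ℂ) (w z) * z.im * z.im) ∂arcLength =
      ((∫ z, ‖w z‖ ^ 2 ∂arcLength : ℝ) : ℂ) := by
    rw [← integral_complex_ofReal]
    refine integral_congr_ae (ae_arcLength_norm.mono fun z hz => ?_)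
    have e : (z.re : ℂ) * z.re + z.im * z.im = 1 := by
      have := Complex.normSq_apply z
      rw [Complex.normSq_eq_norm_sq, hz, one_pow] at this
      exact_mod_cast this.symm
    simp only
    rw [Complex.mul_conj, Complex.normSq_eq_norm_sq]
    linear_combination ((‖w z‖ ^ 2 : ℝ) : ℂ) * e
  rw [e1] at h
  have hle : ∫ z, ‖w z‖ ^ 2 ∂arcLength ≤ ∫ z, (3 * ‖w z‖ ^ 2 + gradSq w z) ∂lebDisk := by
    have h0 : ∫ z, ‖w z‖ ^ 2 ∂arcLength ≤ ‖((∫ z, ‖w z‖ ^ 2 ∂arcLength : ℝ) : ℂ)‖ := by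
      rw [Complex.norm_real]; exact Real.le_norm_self _
    refine h0.trans ?_
    rw [← h]
    refine norm_integral_le_of_norm_le
      (integrable_of_continuous ae_lebDisk_mem (by fun_prop)) (ae_lebDisk_mem.mono fun z hz => ?_)
    have hz' : z.re ^ 2 + z.im ^ 2 ≤ 1 := by
      rw [disk, mem_closedBall_zero_iff] at hz
      have := Complex.normSq_apply z
      rw [Complex.normSq_eq_norm_sq] at this
      nlinarith [norm_nonneg z]
    set p := fderiv ℝ w z 1
    set q := fderiv ℝ w z Complex.I
    have b : ∀ (t : ℝ) (p : ℂ),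
        ‖(w z * (starRingEnd ℂ) p + p * (starRingEnd ℂ) (w z)) * (t : ℂ)‖ ≤
          t ^ 2 * ‖w z‖ ^ 2 + ‖p‖ ^ 2 := by
      intro t p
      have : ‖w z * (starRingEnd ℂ) p + p * (starRingEnd ℂ) (w z)‖ ≤ 2 * (‖w z‖ * ‖p‖) := by
        refine (norm_add_le _ _).trans_eq ?_
        rw [norm_mul, norm_mul, RCLike.norm_conj, RCLike.norm_conj]; ring
      rw [norm_mul, Complex.norm_real, Real.norm_eq_abs, ← sq_abs t]
      nlinarith [sq_nonneg (|t| * ‖w z‖ - ‖p‖), abs_nonneg t,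
        mul_le_mul_of_nonneg_right this (abs_nonneg t)]
    have n1 : ‖w z * (starRingEnd ℂ) (w z)‖ = ‖w z‖ ^ 2 := by
      rw [norm_mul, RCLike.norm_conj, sq]
    have eq : w z * (starRingEnd ℂ) (w z) * ((1 : ℂ).re : ℂ) +
        (w z * (starRingEnd ℂ) p + p * (starRingEnd ℂ) (w z)) * (z.re : ℂ) +
        (w z * (starRingEnd ℂ) (w z) * (Complex.I.im : ℂ) +
        (w z * (starRingEnd ℂ) q + q * (starRingEnd ℂ) (w z)) * (z.im : ℂ)) =
        w z * (starRingEnd ℂ) (w z) + w z * (starRingEnd ℂ) (w z) +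
        ((w z * (starRingEnd ℂ) p + p * (starRingEnd ℂ) (w z)) * (z.re : ℂ) +
        (w z * (starRingEnd ℂ) q + q * (starRingEnd ℂ) (w z)) * (z.im : ℂ)) := by
      simp; ring
    rw [eq]
    refine (norm_add_le _ _).trans
      ((add_le_add (norm_add_le _ _) (norm_add_le _ _)).trans ?_)
    rw [n1, gradSq]
    nlinarith [b z.re p, b z.im q, sq_nonneg ‖w z‖]
  refine hle.trans_eq ?_
  rw [integral_add, integral_const_mul]
  all_goals exact integrable_of_continuous ae_lebDisk_mem (by fun_prop)

theorem fderiv_fderiv_comm {u : ℂ → ℂ} (hu : ContDiff ℝ ∞ u) (z a b : ℂ) :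
    fderiv ℝ (fun z => fderiv ℝ u z a) z b = fderiv ℝ (fun z => fderiv ℝ u z b) z a := by
  have h : ∀ a b : ℂ, fderiv ℝ (fun z => fderiv ℝ u z a) z b =
      fderiv ℝ (fderiv ℝ u) z b a := by
    intro a b
    have hd : DifferentiableAt ℝ (fderiv ℝ u) z :=
      (hu.fderiv_right (m := ∞) (by simp)).differentiable (by simp) z
    rw [fderiv_clm_apply hd (differentiableAt_const _)]
    simp
  rw [h, h]
  exact (hu.contDiffAt.isSymmSndFDerivAt (by simpa using ENat.LEInfty.out)) b a

/-- The derivative of `u` along the circle, `∂u/∂θ` at the points of the circle. -/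
def tangDeriv (u : ℂ → ℂ) (z : ℂ) : ℂ :=
  fderiv ℝ u z Complex.I * z.re - fderiv ℝ u z 1 * z.im

/-- Stokes' theorem for the one-form `ū du`. -/
theorem stokes_conj_mul {u : ℂ → ℂ} (hu : ContDiff ℝ ∞ u) :
    ∫ z, ((starRingEnd ℂ) (fderiv ℝ u z 1) * fderiv ℝ u z Complex.I -
      (starRingEnd ℂ) (fderiv ℝ u z Complex.I) * fderiv ℝ u z 1) ∂lebDisk =
      ∫ z, (starRingEnd ℂ) (u z) * tangDeriv u z ∂arcLength := by
  have hc : ContDiff ℝ ∞ fun z => (starRingEnd ℂ) (u z) := contDiff_conj hu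
  have hn : ContDiff ℝ ∞ fun z => - (starRingEnd ℂ) (u z) := hc.neg
  have hx := contDiff_fderiv_apply hu 1
  have hy := contDiff_fderiv_apply hu Complex.I
  have h := divergence_disk ((hc.mul hy).of_le (by simp)) ((hn.mul hx).of_le (by simp))
  refine Eq.trans (integral_congr_ae (ae_of_all _ fun z => ?_))
    (h.trans (integral_congr_ae (ae_of_all _ fun z => ?_)))
  · simp only [fderiv_mul_apply hc hy, fderiv_mul_apply hn hx, fderiv_fun_neg,
      _root_.neg_apply, fderiv_conj_apply hu, fderiv_fderiv_comm hu z 1 Complex.I]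
    ring
  · simp only [tangDeriv]
    ring

/-- Inversion reverses the direction in which the circle is traversed. -/
theorem tangDeriv_glue {u v : ℂ → ℂ} (hu : ContDiff ℝ ∞ u) (hv : ContDiff ℝ ∞ v)
    (h : ∀ z : ℂ, ‖z‖ = 1 → u z = v (1 / z)) {z : ℂ} (hz : ‖z‖ = 1) :
    tangDeriv u z = - tangDeriv v (1 / z) := by
  obtain ⟨θ, rfl⟩ := (Complex.norm_eq_one_iff z).1 hz
  have h1 := hasDerivAt_angular (hu.of_le (by simp)) 1 θ
  have h2 := (hasDerivAt_angular (hv.of_le (by simp)) 1 (-θ)).scomp θ (hasDerivAt_neg θ)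
  have e : (fun θ : ℝ => u ((1 : ℝ) * Complex.exp (θ * Complex.I))) =
      (fun θ : ℝ => v ((1 : ℝ) * Complex.exp (θ * Complex.I))) ∘ fun θ => -θ := by
    funext θ
    have := h (Complex.exp (θ * Complex.I)) (Complex.norm_exp_ofReal_mul_I θ)
    simpa [Complex.exp_neg] using this
  rw [e] at h1
  have h3 := h1.unique h2
  have e2 : 1 / Complex.exp (θ * Complex.I) = Complex.exp (((-θ : ℝ) : ℂ) * Complex.I) := by
    simp [Complex.exp_neg]
  rw [e2, tangDeriv, tangDeriv, Complex.exp_ofReal_mul_I_re, Complex.exp_ofReal_mul_I_im,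
    Complex.exp_ofReal_mul_I_re, Complex.exp_ofReal_mul_I_im]
  simp only [Complex.ofReal_one, one_mul, neg_smul, one_smul] at h3
  linear_combination h3

/-- On glued pairs the boundary terms `∮ ū du` of the two disks cancel. -/
theorem stokes_glue {u v : ℂ → ℂ} (hu : ContDiff ℝ ∞ u) (hv : ContDiff ℝ ∞ v)
    (h : ∀ z : ℂ, ‖z‖ = 1 → u z = v (1 / z)) :
    ∫ z, (starRingEnd ℂ) (u z) * tangDeriv u z ∂arcLength =
      - ∫ z, (starRingEnd ℂ) (v z) * tangDeriv v z ∂arcLength := by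
  rw [← integral_inversion fun z => (starRingEnd ℂ) (v z) * tangDeriv v z, ← integral_neg]
  refine integral_congr_ae (ae_arcLength_norm.mono fun z hz => ?_)
  simp only [h z hz, tangDeriv_glue hu hv h hz]
  ring

/-! ### A priori estimates for glued pairs of smooth functions -/

/-- The class of `∂w/∂x` or `∂w/∂y` in `L²(𝔻)`, for `e = 1` and `e = i`. -/
def derivL2 (e : ℂ) : smoothFun →ₗ[ℂ] Lp ℂ 2 lebDisk := toL2 ae_lebDisk_mem ∘ₗ partialDeriv e

/-- The class of `∂w/∂z̄` in `L²(𝔻)`. -/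
def dbarL2 : smoothFun →ₗ[ℂ] Lp ℂ 2 lebDisk :=
  (1 / 2 : ℂ) • (derivL2 1 + Complex.I • derivL2 Complex.I)

theorem dbarL2_apply (w : smoothFun) :
    dbarL2 w = (1 / 2 : ℂ) • (derivL2 1 w + Complex.I • derivL2 Complex.I w) := rfl

theorem integral_gradSq (w : smoothFun) :
    ∫ z, gradSq w z ∂lebDisk = ‖derivL2 1 w‖ ^ 2 + ‖derivL2 Complex.I w‖ ^ 2 := by
  have h : ∀ e, Integrable (fun z => ‖fderiv ℝ (w : ℂ → ℂ) z e‖ ^ 2) lebDisk := fun e =>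
    integrable_of_continuous ae_lebDisk_mem
      ((continuous_fderiv_apply (contDiff_smoothFun w) e).norm.pow 2)
  rw [derivL2, derivL2, LinearMap.comp_apply, LinearMap.comp_apply, norm_sq_toL2, norm_sq_toL2]
  exact integral_add (h 1) (h Complex.I)

/-- `4 |∂̄w|² = |∇w|² + 2 Re (i w̄_x w_y)`, and the integral of the last term is a boundary integral
by Stokes' theorem. -/
theorem four_mul_norm_sq_dbarL2 (w : smoothFun) :
    ((4 * ‖dbarL2 w‖ ^ 2 : ℝ) : ℂ) =
      ((‖derivL2 1 w‖ ^ 2 + ‖derivL2 Complex.I w‖ ^ 2 : ℝ) : ℂ) +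
      Complex.I * ∫ z, (starRingEnd ℂ) ((w : ℂ → ℂ) z) * tangDeriv w z ∂arcLength := by
  have hw := contDiff_smoothFun w
  have c1 := continuous_fderiv_apply hw 1
  have c2 := continuous_fderiv_apply hw Complex.I
  have e1 : ∀ a b : ℂ, inner ℂ (derivL2 a w) (derivL2 b w) =
      ∫ z, (starRingEnd ℂ) (fderiv ℝ (w : ℂ → ℂ) z a) * fderiv ℝ (w : ℂ → ℂ) z b ∂lebDisk := by
    intro a b
    rw [derivL2, derivL2, LinearMap.comp_apply, LinearMap.comp_apply, inner_toL2]
    refine integral_congr_ae ((coeFn_toL2 ae_lebDisk_mem (partialDeriv a w)).mono fun z hz => ?_)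
    simp only [hz]
    exact mul_comm _ _
  have e2 : ‖dbarL2 w‖ ^ 2 = 1 / 4 * ‖derivL2 1 w + Complex.I • derivL2 Complex.I w‖ ^ 2 := by
    rw [dbarL2_apply, norm_smul, mul_pow]; norm_num
  rw [← stokes_conj_mul hw, integral_sub, ← e1, ← e1, e2, @norm_add_sq ℂ, norm_smul,
    Complex.norm_I, inner_smul_right, one_mul,
    ← inner_conj_symm (derivL2 Complex.I w) (derivL2 1 w)]
  · set c := inner ℂ (derivL2 1 w) (derivL2 Complex.I w)
    apply Complex.ext <;> simp
    ring
  all_goals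
    refine integrable_of_continuous ae_lebDisk_mem ?_
    fun_prop

/-- On glued pairs the gradient is controlled by `∂̄`: in `|∂̄u|² - |∂u|²` the integrand is the
differential of `ū du`, up to a constant factor, and the boundary terms cancel. -/
theorem energy_identity {u v : smoothFun}
    (h : ∀ z : ℂ, ‖z‖ = 1 → (u : ℂ → ℂ) z = (v : ℂ → ℂ) (1 / z)) :
    (‖derivL2 1 u‖ ^ 2 + ‖derivL2 Complex.I u‖ ^ 2) +
      (‖derivL2 1 v‖ ^ 2 + ‖derivL2 Complex.I v‖ ^ 2) =
      4 * (‖dbarL2 u‖ ^ 2 + ‖dbarL2 v‖ ^ 2) := by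
  have e1 := four_mul_norm_sq_dbarL2 u
  have e2 := four_mul_norm_sq_dbarL2 v
  have e3 := stokes_glue (contDiff_smoothFun u) (contDiff_smoothFun v) h
  refine Complex.ofReal_injective ?_
  push_cast at e1 e2 ⊢
  linear_combination -e1 - e2 - Complex.I * e3

theorem arcLength_real_univ : arcLength.real Set.univ = 2 * Real.pi := by
  rw [arcLength, map_measureReal_apply (by fun_prop) MeasurableSet.univ]
  simp only [Set.preimage_univ, measureReal_restrict_apply_univ, Real.volume_real_Ioc]
  rw [max_eq_left (by linarith [Real.pi_pos])]
  ring

theorem volume_real_disk : volume.real disk = Real.pi := by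
  rw [disk, Measure.real, Complex.volume_closedBall]
  simp

theorem integral_norm_sub_const_sq {m : Measure ℂ} [IsFiniteMeasure m] (hm : ∀ᵐ z ∂m, z ∈ disk)
    {w : ℂ → ℂ} (hw : Continuous w) (c : ℂ) (h : ∫ z, w z ∂m = 0) :
    ∫ z, ‖w z - c‖ ^ 2 ∂m = ∫ z, ‖w z‖ ^ 2 ∂m + m.real Set.univ * ‖c‖ ^ 2 := by
  have i1 : Integrable (fun z => ‖w z‖ ^ 2) m := integrable_of_continuous hm (by fun_prop)
  have i2 : Integrable w m := integrable_of_continuous hm hw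
  have i3 : Integrable (fun z => inner ℝ (w z) c) m :=
    integrable_of_continuous hm (by fun_prop)
  have e : ∫ z, inner ℝ (w z) c ∂m = 0 := by
    simp only [real_inner_comm c]
    rw [integral_inner i2, h, inner_zero_right]
  simp only [norm_sub_sq_real]
  rw [integral_add (by exact i1.sub (i3.const_mul 2)) (integrable_const _),
    integral_sub i1 (i3.const_mul 2), integral_const_mul, e]
  simp

/-- Functions whose mean value on the circle is zero are controlled by their gradient, both on
the circle and on the disk. -/
theorem norm_le_of_mean_zero {w : ℂ → ℂ} (hw : ContDiff ℝ ∞ w) (h : ∫ z, w z ∂arcLength = 0) :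
    ∫ z, ‖w z‖ ^ 2 ∂arcLength ≤ 25 * ∫ z, gradSq w z ∂lebDisk ∧
    ∫ z, ‖w z‖ ^ 2 ∂lebDisk ≤ 41 * ∫ z, gradSq w z ∂lebDisk := by
  have cw := hw.continuous
  -- `c` is the mean value on the disk
  set c : ℂ := (Real.pi : ℂ)⁻¹ * ∫ z, w z ∂lebDisk with hc
  have hv : ContDiff ℝ ∞ fun z => w z - c := hw.sub contDiff_const
  have hg : ∀ z, gradSq (fun z => w z - c) z = gradSq w z := fun z => by
    simp only [gradSq, fderiv_sub_const]
  have i1 : Integrable w lebDisk := integrable_of_continuous ae_lebDisk_mem cw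
  have hcd : lebDisk.real Set.univ = Real.pi := by
    rw [lebDisk, measureReal_restrict_apply_univ, volume_real_disk]
  have h0 : ∫ z, (w z - c) ∂lebDisk = 0 := by
    rw [integral_sub i1 (integrable_const _), integral_const, hcd, hc, Complex.real_smul,
      mul_inv_cancel_left₀ (by exact_mod_cast Real.pi_ne_zero), sub_self]
  have hp := poincare_convex (convex_closedBall 0 1) disk_measurable subset_rfl (d := 2)
    (fun x hx y hy => by
      rw [mem_closedBall_zero_iff] at hx hy
      exact (norm_sub_le _ _).trans (by linarith)) (hv.of_le (by simp))
  have h0' : ∫ z in Metric.closedBall 0 1, (w z - c) = 0 := h0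
  rw [h0'] at hp
  change ∫ z, ‖w z - c‖ ^ 2 ∂lebDisk ≤
    _ + 2 * 2 ^ 2 * ∫ z, gradSq (fun z => w z - c) z ∂lebDisk at hp
  -- as `w` has mean zero on the circle, `|c|²` is bounded by the trace inequality for `w - c`
  have ht := trace_inequality hv
  simp only [hg, norm_zero] at hp ht
  rw [integral_norm_sub_const_sq ae_arcLength_mem cw c h, arcLength_real_univ] at ht
  have hn : 0 ≤ ∫ z, ‖w z‖ ^ 2 ∂arcLength := integral_nonneg fun z => by positivity
  have hcn : 0 ≤ Real.pi * ‖c‖ ^ 2 := by positivity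
  refine ⟨by linarith, ?_⟩
  have h2 : ∫ z, ‖w z‖ ^ 2 ∂lebDisk ≤ ∫ z, (2 * ‖w z - c‖ ^ 2 + 2 * ‖c‖ ^ 2) ∂lebDisk := by
    refine integral_mono (integrable_of_continuous ae_lebDisk_mem (by fun_prop))
      (integrable_of_continuous ae_lebDisk_mem (by fun_prop)) fun z => ?_
    have := norm_add_le (w z - c) c
    rw [sub_add_cancel] at this
    nlinarith [sq_nonneg (‖w z - c‖ - ‖c‖), norm_nonneg (w z)]
  rw [integral_add (integrable_of_continuous ae_lebDisk_mem (by fun_prop)) (integrable_const _),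
    integral_const_mul, integral_const, hcd, smul_eq_mul] at h2
  linarith

/-! ### Control by finitely many averages -/

/-- The part of the disk in the square of side `1/n` with lower left corner `(i₁ + i₂ I) / n`. -/
def cell (n : ℕ) (i : ℤ × ℤ) : Set ℂ :=
  disk ∩ {z | ⌊n * z.re⌋ = i.1} ∩ {z | ⌊n * z.im⌋ = i.2}

theorem mem_cell {n : ℕ} {i : ℤ × ℤ} {z : ℂ} :
    z ∈ cell n i ↔ z ∈ disk ∧ ⌊n * z.re⌋ = i.1 ∧ ⌊n * z.im⌋ = i.2 := by
  simp only [cell, Set.mem_inter_iff, Set.mem_ofPred_eq, and_assoc]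

theorem measurableSet_cell (n : ℕ) (i : ℤ × ℤ) : MeasurableSet (cell n i) := by
  refine (disk_measurable.inter ?_).inter ?_
  · exact measurableSet_eq_fun (Int.measurable_floor.comp (by fun_prop)) measurable_const
  · exact measurableSet_eq_fun (Int.measurable_floor.comp (by fun_prop)) measurable_const

theorem cell_subset (n : ℕ) (i : ℤ × ℤ) : cell n i ⊆ disk := fun _ h => (mem_cell.1 h).1

theorem convex_cell (n : ℕ) (i : ℤ × ℤ) : Convex ℝ (cell n i) := by
  have h : ∀ (L : ℂ →ₗ[ℝ] ℝ) (k : ℤ), Convex ℝ {z | ⌊n * L z⌋ = k} := by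
    intro L k
    have e : {z | ⌊n * L z⌋ = k} = ((n : ℝ) • L) ⁻¹' Set.Ico (k : ℝ) (k + 1) := by
      ext z
      simp [Int.floor_eq_iff]
    rw [e]
    exact (convex_Ico _ _).linear_preimage _
  exact ((convex_closedBall 0 1).inter (h Complex.reLm i.1)).inter (h Complex.imLm i.2)

theorem norm_sub_le_of_mem_cell {n : ℕ} (hn : 0 < n) {i : ℤ × ℤ} {x y : ℂ} (hx : x ∈ cell n i)
    (hy : y ∈ cell n i) : ‖x - y‖ ≤ 2 / n := by
  have hn' : (0 : ℝ) < n := by exact_mod_cast hn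
  have key : ∀ a b : ℝ, ⌊n * a⌋ = ⌊n * b⌋ → |a - b| ≤ 1 / n := by
    intro a b h
    have := Int.abs_sub_lt_one_of_floor_eq_floor h
    rw [← mul_sub, abs_mul, abs_of_pos hn'] at this
    rw [le_div_iff₀' hn']
    exact this.le
  rw [mem_cell] at hx hy
  have h1 := key _ _ (hx.2.1.trans hy.2.1.symm)
  have h2 := key _ _ (hx.2.2.trans hy.2.2.symm)
  calc ‖x - y‖ ≤ |(x - y).re| + |(x - y).im| := Complex.norm_le_abs_re_add_abs_im _
    _ ≤ 1 / n + 1 / n := by simpa using add_le_add h1 h2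
    _ = 2 / n := by ring

/-- The indices of the cells that meet the disk. -/
def cellIndex (n : ℕ) : Finset (ℤ × ℤ) := Finset.Icc (-n : ℤ) n ×ˢ Finset.Icc (-n : ℤ) n

theorem iUnion_cell (n : ℕ) : ⋃ i ∈ cellIndex n, cell n i = disk := by
  refine Set.Subset.antisymm (Set.iUnion₂_subset fun i _ => cell_subset n i) fun z hz => ?_
  have key : ∀ a : ℝ, |a| ≤ 1 → ⌊n * a⌋ ∈ Finset.Icc (-n : ℤ) n := by
    intro a ha
    rw [abs_le] at ha
    have hn : (0 : ℝ) ≤ n := Nat.cast_nonneg n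
    rw [Finset.mem_Icc]
    constructor
    · rw [Int.le_floor]; push_cast; nlinarith
    · exact_mod_cast (Int.floor_le _).trans (by nlinarith : (n : ℝ) * a ≤ n)
  have hz' : ‖z‖ ≤ 1 := by rwa [disk, mem_closedBall_zero_iff] at hz
  refine Set.mem_iUnion₂.2 ⟨(⌊n * z.re⌋, ⌊n * z.im⌋), ?_, mem_cell.2 ⟨hz, rfl, rfl⟩⟩
  exact Finset.mem_product.2 ⟨key _ ((Complex.abs_re_le_norm z).trans hz'),
    key _ ((Complex.abs_im_le_norm z).trans hz')⟩

theorem integral_eq_sum_cell {f : ℂ → ℝ} (n : ℕ) (hf : Continuous f) :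
    ∫ z, f z ∂lebDisk = ∑ i ∈ cellIndex n, ∫ z in cell n i, f z := by
  rw [lebDisk, ← iUnion_cell n, integral_biUnion_finset]
  · exact fun i _ => measurableSet_cell n i
  · intro i _ j _ hij
    refine Set.disjoint_left.2 fun z hi hj => hij ?_
    rw [mem_cell] at hi hj
    exact Prod.ext (hi.2.1.symm.trans hj.2.1) (hi.2.2.symm.trans hj.2.2)
  · exact fun i _ => integrableOn_of_subset_disk (cell_subset n i) hf

/-- The Poincaré inequality on each cell: up to a small multiple of the gradient, a function is
controlled by its integrals over the cells. -/
theorem norm_sq_le_cell {n : ℕ} (hn : 0 < n) {w : ℂ → ℂ} (hw : ContDiff ℝ 1 w) :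
    ∫ z, ‖w z‖ ^ 2 ∂lebDisk ≤
      ∑ i ∈ cellIndex n, (volume.real (cell n i))⁻¹ * ‖∫ z in cell n i, w z‖ ^ 2 +
      8 / n ^ 2 * ∫ z, gradSq w z ∂lebDisk := by
  have cw := hw.continuous
  rw [integral_eq_sum_cell n (by fun_prop : Continuous fun z => ‖w z‖ ^ 2),
    integral_eq_sum_cell n (continuous_gradSq hw), Finset.mul_sum, ← Finset.sum_add_distrib]
  refine Finset.sum_le_sum fun i _ => ?_
  refine (poincare_convex (convex_cell n i) (measurableSet_cell n i) (cell_subset n i)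
    (d := 2 / n) (fun x hx y hy => norm_sub_le_of_mem_cell hn hx hy) hw).trans_eq ?_
  ring

/-! ### The core of glued smooth pairs -/

/-- A pair of smooth functions that agree on the circle under `z ↦ 1/z`, normalized by the
condition that the mean value on the circle is zero. -/
structure IsGlued (u v : smoothFun) : Prop where
  glue : ∀ z : ℂ, ‖z‖ = 1 → (u : ℂ → ℂ) z = (v : ℂ → ℂ) (1 / z)
  mean : ∫ z, (u : ℂ → ℂ) z ∂arcLength = 0

theorem integral_eq_of_glue {u v : ℂ → ℂ} (h : ∀ z : ℂ, ‖z‖ = 1 → u z = v (1 / z)) :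
    ∫ z, u z ∂arcLength = ∫ z, v z ∂arcLength := by
  rw [← integral_inversion v]
  exact integral_congr_ae (ae_arcLength_norm.mono fun z hz => h z hz)

theorem glue_symm {u v : ℂ → ℂ} (h : ∀ z : ℂ, ‖z‖ = 1 → u z = v (1 / z)) (z : ℂ)
    (hz : ‖z‖ = 1) : v z = u (1 / z) := by
  rw [h (1 / z) (by simp [hz]), one_div_one_div]

theorem IsGlued.symm {u v : smoothFun} (h : IsGlued u v) : IsGlued v u :=
  ⟨glue_symm h.glue, (integral_eq_of_glue h.glue).symm.trans h.mean⟩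

/-- The space of normalized glued smooth pairs. -/
def gluedPairs : Submodule ℂ (smoothFun × smoothFun) where
  carrier := {s | IsGlued s.1 s.2}
  add_mem' {s t} (hs : IsGlued s.1 s.2) (ht : IsGlued t.1 t.2) := by
    refine (⟨fun z hz => congrArg₂ (· + ·) (hs.glue z hz) (ht.glue z hz), ?_⟩ :
      IsGlued (s.1 + t.1) (s.2 + t.2))
    have h : ∀ w : smoothFun, Integrable (w : ℂ → ℂ) arcLength := fun w =>
      integrable_of_continuous ae_arcLength_mem (continuous_smoothFun w)
    exact (integral_add (h s.1) (h t.1)).trans (by rw [hs.mean, ht.mean, add_zero])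
  zero_mem' := (⟨fun _ _ => rfl, by simp⟩ : IsGlued 0 0)
  smul_mem' c s (hs : IsGlued s.1 s.2) :=
    (⟨fun z hz => congrArg (c * ·) (hs.glue z hz),
      (integral_const_mul c _).trans (by rw [hs.mean, mul_zero])⟩ : IsGlued (c • s.1) (c • s.2))

/-- The component of a glued pair on the first disk. -/
def fstL : gluedPairs →ₗ[ℂ] smoothFun := LinearMap.fst ℂ _ _ ∘ₗ gluedPairs.subtype

/-- The component of a glued pair on the second disk. -/
def sndL : gluedPairs →ₗ[ℂ] smoothFun := LinearMap.snd ℂ _ _ ∘ₗ gluedPairs.subtype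

theorem isGlued (s : gluedPairs) : IsGlued (fstL s) (sndL s) := by exact s.2

/-- The d-bar operator on glued smooth pairs. -/
def dbarCore : gluedPairs →ₗ[ℂ] FormSpace :=
  (WithLp.linearEquiv 2 ℂ (Lp ℂ 2 lebDisk × Lp ℂ 2 lebDisk)).symm.toLinearMap ∘ₗ
    (dbarL2 ∘ₗ fstL).prod (dbarL2 ∘ₗ sndL)

/-- The inclusion of glued smooth pairs into the space of functions. -/
def inclCore : gluedPairs →ₗ[ℂ] FunctionSpace :=
  (WithLp.linearEquiv 2 ℂ (Lp ℂ 2 fsDisk × Lp ℂ 2 fsDisk)).symm.toLinearMap ∘ₗ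
    (toL2 ae_fsDisk_mem ∘ₗ fstL).prod (toL2 ae_fsDisk_mem ∘ₗ sndL)

theorem norm_sq_dbarCore (s : gluedPairs) :
    ‖dbarCore s‖ ^ 2 = ‖dbarL2 (fstL s)‖ ^ 2 + ‖dbarL2 (sndL s)‖ ^ 2 :=
  WithLp.prod_norm_sq_eq_of_L2 _

theorem norm_sq_inclCore (s : gluedPairs) :
    ‖inclCore s‖ ^ 2 = ‖toL2 ae_fsDisk_mem (fstL s)‖ ^ 2 + ‖toL2 ae_fsDisk_mem (sndL s)‖ ^ 2 :=
  WithLp.prod_norm_sq_eq_of_L2 _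

theorem norm_toL2_fsDisk_le (w : smoothFun) :
    ‖toL2 ae_fsDisk_mem w‖ ^ 2 ≤ ‖toL2 ae_lebDisk_mem w‖ ^ 2 := by
  rw [norm_sq_toL2, norm_sq_toL2]
  have c := continuous_smoothFun w
  exact integral_mono_measure fsDisk_le (ae_of_all _ fun z => by positivity)
    (integrable_of_continuous ae_lebDisk_mem (by fun_prop))

/-- The energy identity on the core: the squared `L²` norm of the gradient is `4 ‖∂̄s‖²`. -/
theorem energy_core (s : gluedPairs) :
    ∫ z, gradSq (fstL s) z ∂lebDisk + ∫ z, gradSq (sndL s) z ∂lebDisk = 4 * ‖dbarCore s‖ ^ 2 := by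
  rw [integral_gradSq, integral_gradSq, norm_sq_dbarCore]
  exact energy_identity (isGlued s).glue

theorem integral_gradSq_nonneg (w : smoothFun) : 0 ≤ ∫ z, gradSq w z ∂lebDisk :=
  integral_nonneg fun _ => gradSq_nonneg _ _

theorem norm_derivL2_le {e : ℂ} (he : e = 1 ∨ e = Complex.I) (s : gluedPairs) :
    ‖derivL2 e (fstL s)‖ ≤ 2 * ‖dbarCore s‖ ∧ ‖derivL2 e (sndL s)‖ ≤ 2 * ‖dbarCore s‖ := by
  have h := energy_core s
  rw [integral_gradSq, integral_gradSq] at h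
  have hn := norm_nonneg (dbarCore s)
  rcases he with rfl | rfl <;> constructor <;>
    refine abs_le_of_sq_le_sq' ?_ (by positivity) |>.2 <;>
    nlinarith [sq_nonneg ‖derivL2 1 (fstL s)‖, sq_nonneg ‖derivL2 1 (sndL s)‖,
      sq_nonneg ‖derivL2 Complex.I (fstL s)‖, sq_nonneg ‖derivL2 Complex.I (sndL s)‖]

theorem norm_toL2_arcLength_le (s : gluedPairs) :
    ‖toL2 ae_arcLength_mem (fstL s)‖ ≤ 10 * ‖dbarCore s‖ := by
  have h := energy_core s
  have h1 := (norm_le_of_mean_zero (contDiff_smoothFun (fstL s)) (isGlued s).mean).1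
  have h2 := integral_gradSq_nonneg (sndL s)
  refine abs_le_of_sq_le_sq' ?_ (by positivity) |>.2
  rw [norm_sq_toL2]
  nlinarith

theorem norm_inclCore_le (s : gluedPairs) : ‖inclCore s‖ ≤ 13 * ‖dbarCore s‖ := by
  have h := energy_core s
  have h1 := (norm_le_of_mean_zero (contDiff_smoothFun (fstL s)) (isGlued s).mean).2
  have h2 := (norm_le_of_mean_zero (contDiff_smoothFun (sndL s)) (isGlued s).symm.mean).2
  refine abs_le_of_sq_le_sq' ?_ (by positivity) |>.2
  have h3 := norm_toL2_fsDisk_le (fstL s)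
  have h4 := norm_toL2_fsDisk_le (sndL s)
  rw [norm_sq_toL2] at h3 h4
  rw [norm_sq_inclCore]
  rw [norm_sq_toL2 ae_lebDisk_mem] at h3 h4
  rw [norm_sq_toL2, norm_sq_toL2]
  nlinarith [sq_nonneg ‖dbarCore s‖]

/-! ### The range of `∂̄` on the core is dense -/

theorem fderiv_pow_apply (k : ℕ) (z e : ℂ) :
    fderiv ℝ (fun z : ℂ => z ^ k) z e = e * (k * z ^ (k - 1)) := by
  have h : HasFDerivAt (fun z : ℂ => z ^ k) _ z :=
    (hasDerivAt_pow k z).hasFDerivAt.restrictScalars ℝ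
  rw [h.fderiv]
  simp

theorem contDiff_pow_complex (k : ℕ) : ContDiff ℝ ∞ fun z : ℂ => z ^ k := contDiff_id.pow k

/-- `2 ∂w/∂z̄`, pointwise. -/
def twoDbar (w : ℂ → ℂ) (z : ℂ) : ℂ := fderiv ℝ w z 1 + Complex.I * fderiv ℝ w z Complex.I

theorem twoDbar_const_mul_pow (c d : ℂ) (k : ℕ) (z : ℂ) :
    twoDbar (fun z => c * z ^ k - d) z = 0 := by
  have h : ∀ e, fderiv ℝ (fun z : ℂ => c * z ^ k - d) z e = e * (c * (k * z ^ (k - 1))) := by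
    intro e
    rw [fderiv_sub_const, fderiv_mul_apply contDiff_const (contDiff_pow_complex k),
      fderiv_pow_apply, fderiv_fun_const]
    simp
    ring
  rw [twoDbar, h, h]
  linear_combination (c * (k * z ^ (k - 1))) * Complex.I_mul_I

theorem contDiff_monomial (a b : ℕ) :
    ContDiff ℝ ∞ fun z : ℂ => z ^ a * (starRingEnd ℂ) (z ^ b) :=
  (contDiff_pow_complex a).mul (contDiff_conj (contDiff_pow_complex b))

theorem twoDbar_monomial (a b : ℕ) (z : ℂ) :
    twoDbar (fun z => z ^ a * (starRingEnd ℂ) (z ^ (b + 1))) z =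
      2 * (b + 1) * (z ^ a * (starRingEnd ℂ) z ^ b) := by
  have hc : ContDiff ℝ ∞ fun z : ℂ => (starRingEnd ℂ) (z ^ (b + 1)) :=
    contDiff_conj (contDiff_pow_complex _)
  rw [twoDbar]
  simp only [fderiv_mul_apply (contDiff_pow_complex a) hc,
    fderiv_conj_apply (contDiff_pow_complex _), fderiv_pow_apply]
  simp
  linear_combination (a * z ^ (a - 1) * (starRingEnd ℂ) z ^ (b + 1) -
    z ^ a * ((b + 1) * (starRingEnd ℂ) z ^ b)) * Complex.I_mul_I

theorem twoDbar_add {u v : ℂ → ℂ} (hu : ContDiff ℝ ∞ u) (hv : ContDiff ℝ ∞ v) (z : ℂ) :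
    twoDbar (fun z => u z + v z) z = twoDbar u z + twoDbar v z := by
  simp only [twoDbar]
  rw [fderiv_fun_add (hu.differentiable (by simp) z) (hv.differentiable (by simp) z)]
  simp
  ring

theorem twoDbar_const_mul {u : ℂ → ℂ} (hu : ContDiff ℝ ∞ u) (c z : ℂ) :
    twoDbar (fun z => c * u z) z = c * twoDbar u z := by
  simp only [twoDbar, fderiv_mul_apply contDiff_const hu, fderiv_fun_const]
  simp
  ring

/-- `z^a z̄^(b+1) / (b+1)` has `∂̄` derivative `zᵃ z̄ᵇ`. On the circle it equals `z^(a-b-1) / (b+1)`,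
which is subtracted from it if the exponent is nonnegative and is otherwise continued to the
second disk as a holomorphic function of `1/z`. -/
theorem exists_glued_monomial (a b : ℕ) : ∃ u v : smoothFun, IsGlued u v ∧
    (∀ z, twoDbar u z = 2 * (z ^ a * (starRingEnd ℂ) z ^ b)) ∧ ∀ z, twoDbar v z = 0 := by
  have hb : (b + 1 : ℂ) ≠ 0 := by exact_mod_cast b.succ_ne_zero
  suffices h : ∃ (p q : ℂ) (k l : ℕ), ∀ z : ℂ, ‖z‖ = 1 →
      (b + 1 : ℂ)⁻¹ * (z ^ a * (starRingEnd ℂ) (z ^ (b + 1))) + p * z ^ k = q * (1 / z) ^ l by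
    obtain ⟨p, q, k, l, h⟩ := h
    -- subtracting the constant `c` from both functions normalizes the pair
    set c : ℂ := (2 * Real.pi : ℂ)⁻¹ * ∫ z, q * z ^ l ∂arcLength with hc
    have m1 : ContDiff ℝ ∞ fun z : ℂ =>
        (b + 1 : ℂ)⁻¹ * (z ^ a * (starRingEnd ℂ) (z ^ (b + 1))) :=
      contDiff_const.mul (contDiff_monomial a (b + 1))
    have m2 : ∀ (p : ℂ) (k : ℕ), ContDiff ℝ ∞ fun z : ℂ => p * z ^ k - c := fun p k =>
      (contDiff_const.mul (contDiff_pow_complex k)).sub contDiff_const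
    have hg : IsGlued ⟨fun z => q * z ^ l - c, by exact m2 q l⟩
        ⟨fun z => (b + 1 : ℂ)⁻¹ * (z ^ a * (starRingEnd ℂ) (z ^ (b + 1))) + (p * z ^ k - c),
          by exact m1.add (m2 p k)⟩ := by
      refine ⟨glue_symm fun z hz => ?_, ?_⟩
      · simp only
        rw [← h z hz]
        ring
      · simp only
        rw [integral_sub (integrable_of_continuous ae_arcLength_mem (by fun_prop))
          (integrable_const _), integral_const, arcLength_real_univ, Complex.real_smul, hc]
        push_cast
        rw [mul_inv_cancel_left₀, sub_self]
        simp [Real.pi_ne_zero]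
    refine ⟨_, _, hg.symm, fun z => ?_, fun z => twoDbar_const_mul_pow q c l z⟩
    refine (twoDbar_add m1 (m2 p k) z).trans ?_
    rw [twoDbar_const_mul (contDiff_monomial a (b + 1)), twoDbar_monomial,
      twoDbar_const_mul_pow, add_zero]
    field_simp
  have hz0 : ∀ z : ℂ, ‖z‖ = 1 → z ≠ 0 := fun z hz => by
    rw [← norm_ne_zero_iff, hz]; exact one_ne_zero
  have hconj : ∀ z : ℂ, ‖z‖ = 1 → (starRingEnd ℂ) z = z⁻¹ := fun z hz =>
    (Complex.inv_eq_conj hz).symm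
  rcases le_or_gt (b + 1) a with h | h
  · refine ⟨-(b + 1 : ℂ)⁻¹, 0, a - (b + 1), 0, fun z hz => ?_⟩
    have := pow_sub₀ z (hz0 z hz) h
    rw [this, map_pow, hconj z hz, inv_pow]
    ring
  · refine ⟨0, (b + 1 : ℂ)⁻¹, 0, b + 1 - a, fun z hz => ?_⟩
    have := pow_sub₀ z⁻¹ (inv_ne_zero (hz0 z hz)) h.le
    rw [one_div, this, map_pow, hconj z hz, inv_pow, inv_pow, inv_inv]
    ring

theorem inner_dbarL2 (f : Lp ℂ 2 lebDisk) (w : smoothFun) :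
    inner ℂ f (dbarL2 w) = ∫ z, (1 / 2 * twoDbar w z) * (starRingEnd ℂ) (f z) ∂lebDisk := by
  have e : dbarL2 w = toL2 ae_lebDisk_mem
      ((1 / 2 : ℂ) • (partialDeriv 1 w + Complex.I • partialDeriv Complex.I w)) := by
    rw [map_smul, map_add, map_smul]; rfl
  rw [e, inner_toL2]
  rfl

theorem eq_zero_of_inner_monomials {f : Lp ℂ 2 lebDisk}
    (h : ∀ a b : ℕ, ∫ z, (z ^ a * (starRingEnd ℂ) z ^ b) * (starRingEnd ℂ) (f z) ∂lebDisk = 0) :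
    f = 0 := by
  have hf : Integrable (f : ℂ → ℂ) lebDisk := (Lp.memLp f).integrable (by norm_num)
  have hc : Integrable (fun z => (starRingEnd ℂ) (f z)) lebDisk :=
    (Complex.conjCLE : ℂ →L[ℝ] ℂ).integrable_comp hf
  have key := ae_eq_zero_of_moments hc fun a b => by
    rw [← h a b]
    exact integral_congr_ae (ae_of_all _ fun z => mul_comm _ _)
  refine (Lp.eq_zero_iff_ae_eq_zero).2 (key.mono fun z hz => ?_)
  simpa using hz

theorem denseRange_dbarCore : DenseRange dbarCore := by
  have h : (LinearMap.range dbarCore)ᗮ = ⊥ := by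
    rw [Submodule.eq_bot_iff]
    intro y hy
    have key : ∀ u v : smoothFun, IsGlued u v →
        inner ℂ y.fst (dbarL2 u) + inner ℂ y.snd (dbarL2 v) = 0 := by
      intro u v huv
      have h1 := (Submodule.mem_orthogonal' _ _).1 hy (dbarCore ⟨(u, v), huv⟩) ⟨_, rfl⟩
      rw [WithLp.prod_inner_apply] at h1
      exact h1
    have two : ∀ (f : Lp ℂ 2 lebDisk) (a b : ℕ),
        ∫ z, (1 / 2 * (2 * (z ^ a * (starRingEnd ℂ) z ^ b))) * (starRingEnd ℂ) (f z) ∂lebDisk =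
        ∫ z, (z ^ a * (starRingEnd ℂ) z ^ b) * (starRingEnd ℂ) (f z) ∂lebDisk := fun f a b =>
      integral_congr_ae (ae_of_all _ fun z => by ring)
    have h1 : y.fst = 0 := eq_zero_of_inner_monomials fun a b => by
      obtain ⟨u, v, huv, hu, hv⟩ := exists_glued_monomial a b
      have := key u v huv
      rw [inner_dbarL2, inner_dbarL2] at this
      simp only [hu, hv, two] at this
      simpa using this
    have h2 : y.snd = 0 := eq_zero_of_inner_monomials fun a b => by
      obtain ⟨u, v, huv, hu, hv⟩ := exists_glued_monomial a b
      have := key v u huv.symm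
      rw [inner_dbarL2, inner_dbarL2] at this
      simp only [hu, hv, two] at this
      simpa using this
    exact (WithLp.equiv 2 _).injective (Prod.ext h1 h2)
  have := (Submodule.topologicalClosure_eq_top_iff (K := LinearMap.range dbarCore)).2 h
  rw [← Submodule.dense_iff_topologicalClosure_eq_top] at this
  exact this

/-! ### Limits in `L²` -/

/-- On the disk the Fubini-Study density is at least `1/4`. -/
theorem lebDisk_le : lebDisk ≤ (4 : ℝ≥0∞) • fsDisk := by
  have h : lebDisk.withDensity 1 ≤
      lebDisk.withDensity ((4 : ℝ≥0∞) • fun z => ENNReal.ofReal (1 / (1 + ‖z‖ ^ 2) ^ 2)) := by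
    refine withDensity_mono (ae_lebDisk_mem.mono fun z hz => ?_)
    rw [disk, mem_closedBall_zero_iff] at hz
    rw [Pi.smul_apply, smul_eq_mul, show (4 : ℝ≥0∞) = ENNReal.ofReal 4 by norm_num,
      ← ENNReal.ofReal_mul (by norm_num), Pi.one_apply, ENNReal.one_le_ofReal, mul_one_div,
      one_le_div (by positivity)]
    have : ‖z‖ ^ 2 ≤ 1 := pow_le_one₀ (norm_nonneg z) hz
    nlinarith [sq_nonneg ‖z‖]
  rw [withDensity_one, withDensity_smul _ (by fun_prop)] at h
  exact h

theorem tendsto_eLpNorm_lebDisk {a : ℕ → ℂ → ℂ}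
    (h : Tendsto (fun k => eLpNorm (a k) 2 fsDisk) atTop (𝓝 0)) :
    Tendsto (fun k => eLpNorm (a k) 2 lebDisk) atTop (𝓝 0) := by
  have h4 : Tendsto (fun k => eLpNorm (a k) 2 ((4 : ℝ≥0∞) • fsDisk)) atTop (𝓝 0) := by
    simp only [eLpNorm_smul_measure_of_ne_zero (four_ne_zero), smul_eq_mul]
    simpa using ENNReal.Tendsto.const_mul h (Or.inr (by simp))
  exact tendsto_of_tendsto_of_tendsto_of_le_of_le tendsto_const_nhds h4 (fun _ => zero_le)
    fun k => eLpNorm_mono_measure _ lebDisk_le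

theorem tendsto_eLpNorm_of_toL2 {m : Measure ℂ} [IsFiniteMeasure m] (hm : ∀ᵐ z ∂m, z ∈ disk)
    {w : ℕ → smoothFun} {f : Lp ℂ 2 m} (h : Tendsto (fun k => toL2 hm (w k)) atTop (𝓝 f)) :
    Tendsto (fun k => eLpNorm (fun z => (w k : ℂ → ℂ) z - f z) 2 m) atTop (𝓝 0) := by
  rw [Lp.tendsto_Lp_iff_tendsto_eLpNorm'] at h
  refine h.congr fun k => eLpNorm_congr_ae ?_
  filter_upwards [coeFn_toL2 hm (w k)] with z hz
  simp only [Pi.sub_apply, hz]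

/-- Convergence in `L²` implies convergence of the integrals against a bounded function. -/
theorem tendsto_integral_mul {m : Measure ℂ} [IsFiniteMeasure m] (hm : ∀ᵐ z ∂m, z ∈ disk)
    {a : ℕ → ℂ → ℂ} {b : ℂ → ℂ} (ha : ∀ k, MemLp (a k) 2 m) (hb : MemLp b 2 m)
    (h : Tendsto (fun k => eLpNorm (fun z => a k z - b z) 2 m) atTop (𝓝 0))
    {φ : ℂ → ℂ} (hφ : Continuous φ) :
    Tendsto (fun k => ∫ z, a k z * φ z ∂m) atTop (𝓝 (∫ z, b z * φ z ∂m)) := by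
  obtain ⟨C, hC⟩ := (isCompact_closedBall (0 : ℂ) 1).exists_bound_of_continuousOn hφ.continuousOn
  have hi : ∀ f : ℂ → ℂ, MemLp f 2 m → Integrable (fun z => f z * φ z) m := fun f hf =>
    (hf.integrable (by norm_num)).mul_bdd hφ.aestronglyMeasurable (hm.mono hC)
  refine tendsto_integral_of_L1' _ (hi b hb).1 (Eventually.of_forall fun k => hi _ (ha k)) ?_
  have hle : ∀ k, eLpNorm ((fun z => a k z * φ z) - fun z => b z * φ z) 1 m ≤
      ENNReal.ofReal C * (eLpNorm (fun z => a k z - b z) 2 m *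
        m Set.univ ^ (1 / (1 : ℝ≥0∞).toReal - 1 / (2 : ℝ≥0∞).toReal)) := by
    intro k
    refine (eLpNorm_le_mul_eLpNorm_of_ae_le_mul (g := fun z => a k z - b z) (c := C)
      (hm.mono fun z hz => ?_) 1).trans ?_
    · rw [Pi.sub_apply, ← sub_mul, norm_mul, mul_comm]
      exact mul_le_mul_of_nonneg_right (hC z hz) (norm_nonneg _)
    · gcongr
      exact eLpNorm_le_eLpNorm_mul_rpow_measure_univ (by norm_num) ((ha k).1.sub hb.1)
  refine tendsto_of_tendsto_of_tendsto_of_le_of_le tendsto_const_nhds ?_ (fun _ => zero_le) hle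
  have h1 := ENNReal.Tendsto.mul_const (b := m Set.univ ^
    (1 / (1 : ℝ≥0∞).toReal - 1 / (2 : ℝ≥0∞).toReal)) h (Or.inr (by
      refine ENNReal.rpow_ne_top_of_nonneg (by norm_num) (measure_ne_top _ _)))
  have h2 := ENNReal.Tendsto.const_mul (a := ENNReal.ofReal C) h1 (Or.inr ENNReal.ofReal_ne_top)
  simpa using h2

theorem IsWeakDeriv.of_tendsto {e : ℂ} {w dw : ℕ → ℂ → ℂ} {u g : ℂ → ℂ}
    (h : ∀ k, IsWeakDeriv e (w k) (dw k)) (mw : ∀ k, MemLp (w k) 2 lebDisk)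
    (mdw : ∀ k, MemLp (dw k) 2 lebDisk) (mu : MemLp u 2 lebDisk) (mg : MemLp g 2 lebDisk)
    (hu : Tendsto (fun k => eLpNorm (fun z => w k z - u z) 2 lebDisk) atTop (𝓝 0))
    (hg : Tendsto (fun k => eLpNorm (fun z => dw k z - g z) 2 lebDisk) atTop (𝓝 0)) :
    IsWeakDeriv e u g := by
  intro φ h1 h2 h3
  have t1 := tendsto_integral_mul ae_lebDisk_mem mw mu hu (continuous_fderiv_apply h1 e)
  have t2 := tendsto_integral_mul ae_lebDisk_mem mdw mg hg h1.continuous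
  refine tendsto_nhds_unique t1 (t2.neg.congr fun k => ?_)
  exact (h k φ h1 h2 h3).symm

/-- A limit of smooth functions, in the graph norm of `H¹` and of the restriction to the circle,
is in `H¹(𝔻)` and has the limit of the restrictions as its trace. -/
theorem isTrace_of_tendsto {w : ℕ → smoothFun} {u : Lp ℂ 2 fsDisk} {ux uy : Lp ℂ 2 lebDisk}
    {g : ℂ → ℂ} (hu : Tendsto (fun k => toL2 ae_fsDisk_mem (w k)) atTop (𝓝 u))
    (hx : Tendsto (fun k => derivL2 1 (w k)) atTop (𝓝 ux))
    (hy : Tendsto (fun k => derivL2 Complex.I (w k)) atTop (𝓝 uy)) (mg : MemLp g 2 arcLength)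
    (hg : Tendsto (fun k => eLpNorm (fun z => (w k : ℂ → ℂ) z - g z) 2 arcLength) atTop (𝓝 0)) :
    IsSobolev u ux uy ∧ IsTrace u g := by
  have tu := tendsto_eLpNorm_lebDisk (tendsto_eLpNorm_of_toL2 _ hu)
  have tx := tendsto_eLpNorm_of_toL2 (w := fun k => partialDeriv 1 (w k)) ae_lebDisk_mem hx
  have ty := tendsto_eLpNorm_of_toL2 (w := fun k => partialDeriv Complex.I (w k))
    ae_lebDisk_mem hy
  have mw : ∀ w : smoothFun, MemLp (w : ℂ → ℂ) 2 lebDisk := fun w =>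
    memLp_of_continuous ae_lebDisk_mem (continuous_smoothFun w)
  have mu : MemLp u 2 lebDisk :=
    ((Lp.memLp u).smul_measure (c := 4) (by simp)).mono_measure lebDisk_le
  have hs : IsSobolev u ux uy :=
    ⟨mu, Lp.memLp ux, Lp.memLp uy,
      IsWeakDeriv.of_tendsto (fun k => (isWeakDeriv_smooth (contDiff_smoothFun (w k))).1)
        (fun k => mw _) (fun k => mw (partialDeriv 1 (w k))) mu (Lp.memLp ux) tu tx,
      IsWeakDeriv.of_tendsto (fun k => (isWeakDeriv_smooth (contDiff_smoothFun (w k))).2)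
        (fun k => mw _) (fun k => mw (partialDeriv Complex.I (w k))) mu (Lp.memLp uy) tu ty⟩
  exact ⟨hs, mg, ux, uy, hs, fun k => w k, fun k => contDiff_smoothFun (w k), tu, tx, ty, hg⟩

/-! ### The right inverse -/

/-- Extension by continuity of `e s ↦ T s`. Subtraction on `V` is recovered from the scalar
multiplication, so that only the monoid structure of `V` enters. -/
theorem exists_extension {V F E : Type*} [AddCommMonoid V] [Module ℂ V] [NormedAddCommGroup F]
    [NormedSpace ℂ F] [NormedAddCommGroup E] [NormedSpace ℂ E] [CompleteSpace E] {e : V →ₗ[ℂ] F}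
    (he : DenseRange e) {T : V →ₗ[ℂ] E} {C : ℝ} (hT : ∀ s, ‖T s‖ ≤ C * ‖e s‖) :
    ∃ L : F →L[ℂ] E, ∀ s, L (e s) = T s := by
  let := Module.addCommMonoidToAddCommGroup ℂ (M := V)
  exact ⟨T.extendOfNorm e, LinearMap.extendOfNorm_eq he ⟨C, hT⟩⟩

theorem exists_tendsto_of_bound {E : Type*} [NormedAddCommGroup E] [NormedSpace ℂ E]
    [CompleteSpace E] {T : gluedPairs →ₗ[ℂ] E} {C : ℝ} (hT : ∀ s, ‖T s‖ ≤ C * ‖dbarCore s‖)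
    {s : ℕ → gluedPairs} {y : FormSpace} (h : Tendsto (fun k => dbarCore (s k)) atTop (𝓝 y)) :
    ∃ l, Tendsto (fun k => T (s k)) atTop (𝓝 l) := by
  obtain ⟨L, hL⟩ := exists_extension denseRange_dbarCore hT
  exact ⟨L y, ((L.continuous.tendsto y).comp h).congr fun k => hL (s k)⟩

/-- The inverse of the d-bar operator on normalized glued pairs, extended by continuity. -/
def dbarInv : FormSpace →L[ℂ] FunctionSpace :=
  (exists_extension denseRange_dbarCore norm_inclCore_le).choose

theorem dbarInv_dbarCore (s : gluedPairs) : dbarInv (dbarCore s) = inclCore s :=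
  (exists_extension denseRange_dbarCore norm_inclCore_le).choose_spec s

theorem tendsto_fst {E F : Type*} [NormedAddCommGroup E] [NormedAddCommGroup F]
    {x : ℕ → WithLp 2 (E × F)} {y : WithLp 2 (E × F)} (h : Tendsto x atTop (𝓝 y)) :
    Tendsto (fun k => (x k).fst) atTop (𝓝 y.fst) ∧
    Tendsto (fun k => (x k).snd) atTop (𝓝 y.snd) := by
  have h1 := ((WithLp.prod_continuous_ofLp 2 E F).tendsto y).comp h
  exact ⟨(continuous_fst.tendsto _).comp h1, (continuous_snd.tendsto _).comp h1⟩

theorem dbarFun_of_tendsto {w : ℕ → smoothFun} {u : ℂ → ℂ} {ux uy f : Lp ℂ 2 lebDisk}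
    (hu : MemSobolev u) (hs : IsSobolev u ux uy)
    (hx : Tendsto (fun k => derivL2 1 (w k)) atTop (𝓝 ux))
    (hy : Tendsto (fun k => derivL2 Complex.I (w k)) atTop (𝓝 uy))
    (hf : Tendsto (fun k => dbarL2 (w k)) atTop (𝓝 f)) : dbarFun u hu = f := by
  rw [dbarFun_eq hu hs, Lp.toLp_coeFn, Lp.toLp_coeFn]
  exact tendsto_nhds_unique ((hx.add (hy.const_smul Complex.I)).const_smul (1 / 2 : ℂ)) hf

/-- If `∂̄s` converges for glued smooth pairs `s`, then by the a priori estimates so do `s`, its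
gradient and its boundary values; the limit is in the domain, and its `∂̄` is the limit of `∂̄s`. -/
theorem isRightInverse_dbarInv : IsRightInverse dbar dbarInv := by
  intro y
  obtain ⟨f, hf1, hf2⟩ := mem_closure_iff_seq_limit.1 (denseRange_dbarCore y)
  choose s hs using hf1
  have h : Tendsto (fun k => dbarCore (s k)) atTop (𝓝 y) := by simpa only [hs] using hf2
  have tQ : Tendsto (fun k => inclCore (s k)) atTop (𝓝 (dbarInv y)) :=
    ((dbarInv.continuous.tendsto y).comp h).congr fun k => dbarInv_dbarCore (s k)
  have bounds_x := norm_derivL2_le (e := 1) (Or.inl rfl)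
  have bounds_y := norm_derivL2_le (e := Complex.I) (Or.inr rfl)
  obtain ⟨x1, tx1⟩ := exists_tendsto_of_bound (T := derivL2 1 ∘ₗ fstL) (fun s => (bounds_x s).1) h
  obtain ⟨y1, ty1⟩ := exists_tendsto_of_bound (T := derivL2 Complex.I ∘ₗ fstL)
    (fun s => (bounds_y s).1) h
  obtain ⟨x2, tx2⟩ := exists_tendsto_of_bound (T := derivL2 1 ∘ₗ sndL) (fun s => (bounds_x s).2) h
  obtain ⟨y2, ty2⟩ := exists_tendsto_of_bound (T := derivL2 Complex.I ∘ₗ sndL)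
    (fun s => (bounds_y s).2) h
  obtain ⟨g, tg⟩ := exists_tendsto_of_bound (T := toL2 ae_arcLength_mem ∘ₗ fstL)
    norm_toL2_arcLength_le h
  have eg := tendsto_eLpNorm_of_toL2 (w := fun k => fstL (s k)) ae_arcLength_mem tg
  -- on the second disk the boundary values are those of the first, pulled back by inversion
  have mh : MemLp (fun z => g (1 / z)) 2 arcLength :=
    (Lp.memLp g).comp_measurePreserving measurePreserving_inversion
  have eh : Tendsto (fun k => eLpNorm (fun z => (sndL (s k) : ℂ → ℂ) z - g (1 / z)) 2 arcLength)
      atTop (𝓝 0) := by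
    refine eg.congr fun k => ?_
    rw [← eLpNorm_comp_measurePreserving (g := fun z => (fstL (s k) : ℂ → ℂ) z - g z)
      ((continuous_smoothFun (fstL (s k))).aestronglyMeasurable.sub (Lp.memLp g).1)
      measurePreserving_inversion]
    refine eLpNorm_congr_ae (ae_arcLength_norm.mono fun z hz => ?_)
    simp only [Function.comp_apply]
    rw [(isGlued (s k)).symm.glue z hz]
  obtain ⟨s1, t1⟩ := isTrace_of_tendsto (w := fun k => fstL (s k)) (tendsto_fst tQ).1
    tx1 ty1 (Lp.memLp g) eg
  obtain ⟨s2, t2⟩ := isTrace_of_tendsto (w := fun k => sndL (s k)) (tendsto_fst tQ).2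
    tx2 ty2 mh eh
  have hmem : dbarInv y ∈ dbar.domain :=
    ⟨⟨_, _, s1⟩, ⟨_, _, s2⟩, g, fun z => g (1 / z), t1, t2, ae_of_all _ fun z => by simp⟩
  refine ⟨hmem, (WithLp.equiv 2 _).injective (Prod.ext ?_ ?_)⟩
  · exact dbarFun_of_tendsto (w := fun k => fstL (s k)) ⟨_, _, s1⟩ s1 tx1 ty1 (tendsto_fst h).1
  · exact dbarFun_of_tendsto (w := fun k => sndL (s k)) ⟨_, _, s2⟩ s2 tx2 ty2 (tendsto_fst h).2

/-! ### Compactness -/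

/-- An operator on a Hilbert space is compact if it is small on the orthogonal complements of
suitable finite-dimensional subspaces: it is then a norm limit of operators of finite rank. -/
theorem isCompactOperator_of_small_on_orthogonal {E F : Type*} [NormedAddCommGroup F]
    [InnerProductSpace ℂ F] [NormedAddCommGroup E] [NormedSpace ℂ E] [CompleteSpace E]
    (Q : F →L[ℂ] E) (h : ∀ ε > 0, ∃ W : Submodule ℂ F, FiniteDimensional ℂ W ∧
      ∀ x ∈ Wᗮ, ‖Q x‖ ≤ ε * ‖x‖) : IsCompactOperator Q := by
  have hcl := isClosed_setOfPred_isCompactOperator (𝕜₁ := ℂ) (𝕜₂ := ℂ) (σ₁₂ := RingHom.id ℂ)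
    (M₁ := F) (M₂ := E)
  refine hcl.closure_subset (a := Q) (Metric.mem_closure_iff.2 fun ε hε => ?_)
  obtain ⟨W, hW, hQ⟩ := h (ε / 2) (half_pos hε)
  refine ⟨Q.comp W.starProjection, ?_, ?_⟩
  · change IsCompactOperator (Q ∘ W.starProjection)
    have : IsCompactOperator (W.subtypeL.comp W.orthogonalProjectionOnto) :=
      (isCompactOperator_of_locallyCompactSpace_dom
        W.orthogonalProjectionOnto).clm_comp W.subtypeL
    exact this.clm_comp Q
  · rw [dist_eq_norm]
    refine lt_of_le_of_lt (ContinuousLinearMap.opNorm_le_bound _ (half_pos hε).le fun x => ?_)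
      (half_lt_self hε)
    have hx : x - W.starProjection x ∈ Wᗮ := W.sub_starProjection_mem_orthogonal x
    have h1 := hQ _ hx
    have h2 : ‖x - W.starProjection x‖ ≤ ‖x‖ := by
      have := Wᗮ.norm_starProjection_apply_le x
      rwa [Submodule.starProjection_orthogonal'] at this
    simp only [_root_.sub_apply, ContinuousLinearMap.comp_apply]
    rw [← map_sub]
    exact h1.trans (by gcongr)

/-- The indicator function of a cell; the inner product with it is integration over the cell. -/
def cellVec (n : ℕ) (i : ℤ × ℤ) : Lp ℂ 2 lebDisk :=
  indicatorConstLp 2 (measurableSet_cell n i) (measure_ne_top _ _) (1 : ℂ)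

theorem inner_cellVec (n : ℕ) (i : ℤ × ℤ) (w : smoothFun) :
    inner ℂ (cellVec n i) (toL2 ae_lebDisk_mem w) = ∫ z in cell n i, (w : ℂ → ℂ) z := by
  rw [cellVec, L2.inner_indicatorConstLp_one]
  have e : lebDisk.restrict (cell n i) = volume.restrict (cell n i) := by
    rw [lebDisk, Measure.restrict_restrict (measurableSet_cell n i),
      Set.inter_eq_left.2 (cell_subset n i)]
  rw [setIntegral_congr_ae (measurableSet_cell n i)
    ((coeFn_toL2 ae_lebDisk_mem w).mono fun z hz _ => hz), e]

theorem norm_toL2_lebDisk_le (s : gluedPairs) :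
    ‖(toL2 ae_lebDisk_mem ∘ₗ fstL) s‖ ≤ 13 * ‖dbarCore s‖ ∧
    ‖(toL2 ae_lebDisk_mem ∘ₗ sndL) s‖ ≤ 13 * ‖dbarCore s‖ := by
  have h := energy_core s
  have h1 := (norm_le_of_mean_zero (contDiff_smoothFun (fstL s)) (isGlued s).mean).2
  have h2 := (norm_le_of_mean_zero (contDiff_smoothFun (sndL s)) (isGlued s).symm.mean).2
  have h3 := integral_gradSq_nonneg (fstL s)
  have h4 := integral_gradSq_nonneg (sndL s)
  constructor <;>
    refine abs_le_of_sq_le_sq' ?_ (by positivity) |>.2 <;>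
    rw [LinearMap.comp_apply, norm_sq_toL2] <;>
    nlinarith [sq_nonneg ‖dbarCore s‖]

theorem norm_sq_inclCore_le_cell {n : ℕ} (hn : 0 < n) (s : gluedPairs) :
    ‖inclCore s‖ ^ 2 ≤ ∑ i ∈ cellIndex n, (volume.real (cell n i))⁻¹ *
      (‖inner ℂ (cellVec n i) (toL2 ae_lebDisk_mem (fstL s))‖ ^ 2 +
        ‖inner ℂ (cellVec n i) (toL2 ae_lebDisk_mem (sndL s))‖ ^ 2) +
      32 / n ^ 2 * ‖dbarCore s‖ ^ 2 := by
  have h := energy_core s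
  have h1 := norm_sq_le_cell hn ((contDiff_smoothFun (fstL s)).of_le (by simp))
  have h2 := norm_sq_le_cell hn ((contDiff_smoothFun (sndL s)).of_le (by simp))
  have h3 := norm_toL2_fsDisk_le (fstL s)
  have h4 := norm_toL2_fsDisk_le (sndL s)
  rw [norm_sq_toL2 ae_lebDisk_mem] at h3 h4
  simp only [inner_cellVec, mul_add, Finset.sum_add_distrib]
  rw [norm_sq_inclCore]
  have e : 32 / (n : ℝ) ^ 2 * ‖dbarCore s‖ ^ 2 = 8 / (n : ℝ) ^ 2 *
      ∫ z, gradSq (fstL s) z ∂lebDisk + 8 / (n : ℝ) ^ 2 * ∫ z, gradSq (sndL s) z ∂lebDisk := by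
    rw [← mul_add, h]; ring
  rw [e]
  linarith

/-- By density, the bound by averages over the cells holds for all forms. On the forms for which
all averages vanish, a space of finite codimension, the operator is as small as desired. -/
theorem isCompactOperator_dbarInv : IsCompactOperator dbarInv := by
  obtain ⟨U, hU⟩ := exists_extension denseRange_dbarCore fun s => (norm_toL2_lebDisk_le s).1
  obtain ⟨V, hV⟩ := exists_extension denseRange_dbarCore fun s => (norm_toL2_lebDisk_le s).2
  have key : ∀ n : ℕ, 0 < n → ∀ y, ‖dbarInv y‖ ^ 2 ≤
      ∑ i ∈ cellIndex n, (volume.real (cell n i))⁻¹ *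
      (‖inner ℂ (cellVec n i) (U y)‖ ^ 2 + ‖inner ℂ (cellVec n i) (V y)‖ ^ 2) +
      32 / n ^ 2 * ‖y‖ ^ 2 := by
    intro n hn y
    refine denseRange_dbarCore.induction_on y (isClosed_le (by fun_prop) (by fun_prop)) fun s => ?_
    rw [dbarInv_dbarCore, hU, hV]
    exact norm_sq_inclCore_le_cell hn s
  refine isCompactOperator_of_small_on_orthogonal dbarInv fun ε hε => ?_
  obtain ⟨n, hn⟩ := exists_nat_gt (6 / ε)
  have hn0 : (0 : ℝ) < n := (by positivity : (0 : ℝ) < 6 / ε).trans hn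
  -- orthogonality to these vectors says that all averages over the cells vanish
  let S : Set FormSpace := (fun i => U.adjoint (cellVec n i)) '' (cellIndex n) ∪
    (fun i => V.adjoint (cellVec n i)) '' (cellIndex n)
  have hS : S.Finite := ((cellIndex n).finite_toSet.image _).union
    ((cellIndex n).finite_toSet.image _)
  refine ⟨Submodule.span ℂ S, FiniteDimensional.span_of_finite ℂ hS, fun y hy => ?_⟩
  rw [Submodule.mem_orthogonal] at hy
  have h1 : ∀ i ∈ cellIndex n, inner ℂ (cellVec n i) (U y) = 0 := fun i hi => by
    rw [← ContinuousLinearMap.adjoint_inner_left]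
    exact hy _ (Submodule.subset_span (Or.inl ⟨i, hi, rfl⟩))
  have h2 : ∀ i ∈ cellIndex n, inner ℂ (cellVec n i) (V y) = 0 := fun i hi => by
    rw [← ContinuousLinearMap.adjoint_inner_left]
    exact hy _ (Submodule.subset_span (Or.inr ⟨i, hi, rfl⟩))
  have h3 := key n (by exact_mod_cast hn0) y
  rw [Finset.sum_eq_zero fun i hi => by rw [h1 i hi, h2 i hi]; simp, zero_add] at h3
  refine abs_le_of_sq_le_sq' (h3.trans ?_) (by positivity) |>.2
  rw [mul_pow]
  gcongr
  rw [div_lt_iff₀ hε] at hn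
  rw [div_le_iff₀ (by positivity)]
  nlinarith

/-! ### The kernel of the d-bar operator -/

/-- Green's formula for a function in `H¹(𝔻)` with a trace. -/
theorem green_trace {u g ux uy : ℂ → ℂ} (t : IsTrace u g) (s : IsSobolev u ux uy) {φ : ℂ → ℂ}
    (hφ : ContDiff ℝ ∞ φ) :
    ∫ z, u z * twoDbar φ z ∂lebDisk +
      (∫ z, ux z * φ z ∂lebDisk + ∫ z, uy z * (Complex.I * φ z) ∂lebDisk) =
      ∫ z, g z * (z * φ z) ∂arcLength := by
  obtain ⟨mg, vx, vy, s', w, w1, w2, w3, w4, w5⟩ := t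
  have ex := s.weak_x.unique s'.weak_x s.memLp_x s'.memLp_x
  have ey := s.weak_y.unique s'.weak_y s.memLp_y s'.memLp_y
  rw [integral_congr_ae (ex.mono fun z hz => by simp only [hz] :
      (fun z => ux z * φ z) =ᵐ[lebDisk] fun z => vx z * φ z),
    integral_congr_ae (ey.mono fun z hz => by simp only [hz] :
      (fun z => uy z * (Complex.I * φ z)) =ᵐ[lebDisk] fun z => vy z * (Complex.I * φ z))]
  have cφ := hφ.continuous
  have c1 := continuous_fderiv_apply hφ 1
  have c2 := continuous_fderiv_apply hφ Complex.I
  have cd : Continuous (twoDbar φ) := by unfold twoDbar; fun_prop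
  have ml : ∀ f : ℂ → ℂ, Continuous f → MemLp f 2 lebDisk := fun f =>
    memLp_of_continuous ae_lebDisk_mem
  have t1 := tendsto_integral_mul ae_lebDisk_mem (fun k => ml _ (w1 k).continuous) s.memLp w2 cd
  have t2 := tendsto_integral_mul ae_lebDisk_mem
    (fun k => ml _ (continuous_fderiv_apply (w1 k) 1)) s'.memLp_x w3 cφ
  have t3 := tendsto_integral_mul ae_lebDisk_mem
    (fun k => ml _ (continuous_fderiv_apply (w1 k) Complex.I)) s'.memLp_y w4
    (by fun_prop : Continuous fun z => Complex.I * φ z)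
  have t4 := tendsto_integral_mul ae_arcLength_mem
    (fun k => memLp_of_continuous ae_arcLength_mem (w1 k).continuous) mg w5
    (by fun_prop : Continuous fun z => z * φ z)
  refine tendsto_nhds_unique (t1.add (t2.add t3)) (t4.congr fun k => ?_)
  have cw := (w1 k).continuous
  have d1 := continuous_fderiv_apply (w1 k) 1
  have d2 := continuous_fderiv_apply (w1 k) Complex.I
  rw [← green_disk (w1 k) hφ, ← integral_add, ← integral_add]
  · refine integral_congr_ae (ae_of_all _ fun z => ?_)
    simp only [twoDbar]
    ring
  all_goals exact integrable_of_continuous ae_lebDisk_mem (by fun_prop)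

theorem twoDbar_pow (n : ℕ) (z : ℂ) : twoDbar (fun z => z ^ n) z = 0 := by
  have h := twoDbar_const_mul_pow 1 0 n z
  simpa using h

theorem integral_pow_succ_arcLength (n : ℕ) : ∫ z : ℂ, z ^ (n + 1) ∂arcLength = 0 := by
  have h := green_disk (w := fun _ => 1) contDiff_const (contDiff_pow_complex n)
  have e : ∀ z : ℂ, fderiv ℝ (fun z : ℂ => z ^ n) z 1 +
    Complex.I * fderiv ℝ (fun z : ℂ => z ^ n) z Complex.I = 0 := twoDbar_pow n
  simp only [e, fderiv_fun_const] at h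
  simp only [mul_zero, Pi.zero_apply, _root_.zero_apply, add_zero, zero_mul, integral_zero,
    one_mul] at h
  simp only [pow_succ', ← h]

/-- A function on the circle whose moments against `zᵏ` all vanish is orthogonal to the monomials
in `z` and `z̄`. -/
theorem integral_mul_monomial_arcLength {G : ℂ → ℂ} (h0 : ∫ z, G z ∂arcLength = 0)
    (hp : ∀ n : ℕ, ∫ z, G z * z ^ (n + 1) ∂arcLength = 0)
    (hm : ∀ n : ℕ, ∫ z, G z * (1 / z) ^ (n + 1) ∂arcLength = 0) (a b : ℕ) :
    ∫ z, G z * (z ^ a * (starRingEnd ℂ) z ^ b) ∂arcLength = 0 := by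
  have hz : ∀ᵐ z ∂arcLength, z ≠ 0 ∧ (starRingEnd ℂ) z = z⁻¹ :=
    ae_arcLength_norm.mono fun z hz => ⟨by rw [← norm_ne_zero_iff, hz]; exact one_ne_zero,
      (Complex.inv_eq_conj hz).symm⟩
  rcases lt_trichotomy a b with h | rfl | h
  · obtain ⟨k, rfl⟩ := Nat.exists_eq_add_of_lt h
    rw [← hm k]
    refine integral_congr_ae (hz.mono fun z hz => ?_)
    have hz0 := hz.1
    simp only [hz.2, one_div, inv_pow, pow_add]
    field_simp
  · rw [← h0]
    refine integral_congr_ae (hz.mono fun z hz => ?_)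
    have hz0 := hz.1
    simp only [hz.2, inv_pow]
    field_simp
  · obtain ⟨k, rfl⟩ := Nat.exists_eq_add_of_lt h
    rw [← hp k]
    refine integral_congr_ae (hz.mono fun z hz => ?_)
    have hz0 := hz.1
    simp only [hz.2, inv_pow, pow_add]
    field_simp

/-- If `u` and `v` satisfy the Cauchy-Riemann equation and are glued, then `u` is constant: the
boundary values of `u` have no negative Fourier coefficients, those of `v` neither, and the gluing
exchanges the positive and the negative coefficients. -/
theorem ae_const_of_green {u g h : ℂ → ℂ} (mu : MemLp u 2 lebDisk) (mg : MemLp g 2 arcLength)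
    (hu : ∀ φ : ℂ → ℂ, ContDiff ℝ ∞ φ →
      ∫ z, u z * twoDbar φ z ∂lebDisk = ∫ z, g z * (z * φ z) ∂arcLength)
    (hv : ∀ n : ℕ, ∫ z, h z * z ^ (n + 1) ∂arcLength = 0)
    (glue : ∀ᵐ z ∂arcLength, g z = h (1 / z)) : ∃ c : ℂ, u =ᵐ[lebDisk] fun _ => c := by
  -- `c` is the zeroth Fourier coefficient; all moments of `g - c` vanish
  set c : ℂ := (2 * Real.pi : ℂ)⁻¹ * ∫ z, g z ∂arcLength with hc
  have ig : ∀ φ : ℂ → ℂ, Measurable φ → (∀ᵐ z ∂arcLength, ‖φ z‖ ≤ 1) →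
      Integrable (fun z => g z * φ z) arcLength := fun φ h1 h2 =>
    (mg.integrable (by norm_num)).mul_bdd h1.aestronglyMeasurable h2
  have ic : ∀ φ : ℂ → ℂ, Measurable φ → (∀ᵐ z ∂arcLength, ‖φ z‖ ≤ 1) →
      Integrable (fun z => c * φ z) arcLength := fun φ h1 h2 =>
    (Integrable.of_bound h1.aestronglyMeasurable 1 h2).const_mul c
  have bp : ∀ n : ℕ, ∀ᵐ z ∂arcLength, ‖z ^ n‖ ≤ 1 := fun n =>
    ae_arcLength_norm.mono fun z hz => by rw [norm_pow, hz, one_pow]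
  have bm : ∀ n : ℕ, ∀ᵐ z ∂arcLength, ‖(1 / z) ^ n‖ ≤ 1 := fun n =>
    ae_arcLength_norm.mono fun z hz => by rw [norm_pow, norm_div, hz]; simp
  have mom := integral_mul_monomial_arcLength (G := fun z => g z - c)
    (by
      rw [integral_sub (mg.integrable (by norm_num)) (integrable_const _), integral_const,
        arcLength_real_univ, Complex.real_smul, hc]
      push_cast
      rw [mul_inv_cancel_left₀ (by simp [Real.pi_ne_zero]), sub_self])
    (fun n => by
      have e := hu _ (contDiff_pow_complex n)
      simp only [twoDbar_pow, mul_zero, integral_zero] at e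
      simp only [sub_mul]
      rw [integral_sub (ig _ (by fun_prop) (bp _)) (ic _ (by fun_prop) (bp _)),
        integral_const_mul, integral_pow_succ_arcLength]
      simp only [pow_succ', ← e]
      simp)
    (fun n => by
      simp only [sub_mul]
      rw [integral_sub (ig _ (by fun_prop) (bm _)) (ic _ (by fun_prop) (bm _)),
        integral_const_mul, integral_inversion fun z => z ^ (n + 1), integral_pow_succ_arcLength,
        mul_zero, sub_zero, ← hv n, ← integral_inversion fun z => h z * z ^ (n + 1)]
      exact integral_congr_ae (glue.mono fun z hz => by simp only [hz]))
  refine ⟨c, ?_⟩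
  have iu : Integrable (fun z => u z - c) lebDisk :=
    (mu.integrable (by norm_num)).sub (integrable_const c)
  have key := ae_eq_zero_of_moments iu fun a b => by
    -- the monomial is a `∂̄`-derivative
    have hφ := contDiff_monomial a (b + 1)
    have e1 := hu _ hφ
    have e2 := green_disk (w := fun _ => c) contDiff_const hφ
    have e3 : ∀ z : ℂ, fderiv ℝ (fun z : ℂ => z ^ a * (starRingEnd ℂ) (z ^ (b + 1))) z 1 +
        Complex.I * fderiv ℝ (fun z : ℂ => z ^ a * (starRingEnd ℂ) (z ^ (b + 1))) z Complex.I =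
        2 * (b + 1) * (z ^ a * (starRingEnd ℂ) z ^ b) := twoDbar_monomial a b
    simp only [e3, fderiv_fun_const, Pi.zero_apply, _root_.zero_apply, mul_zero, add_zero,
      zero_mul] at e2
    simp only [twoDbar_monomial] at e1
    have e4 := mom (a + 1) (b + 1)
    have i1 : Integrable (fun z => u z * (2 * (b + 1) * (z ^ a * (starRingEnd ℂ) z ^ b)))
        lebDisk := integrable_mul_test mu (by fun_prop)
    have i2 : Integrable (fun z => c * (2 * (b + 1) * (z ^ a * (starRingEnd ℂ) z ^ b)))
        lebDisk := integrable_of_continuous ae_lebDisk_mem (by fun_prop)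
    have i3 : Integrable (fun z => g z * (z * (z ^ a * (starRingEnd ℂ) (z ^ (b + 1)))))
        arcLength := ig _ (by fun_prop) (ae_arcLength_norm.mono fun z hz => by
          simp [hz])
    have i4 : Integrable (fun z => c * (z * (z ^ a * (starRingEnd ℂ) (z ^ (b + 1)))))
        arcLength := integrable_of_continuous ae_arcLength_mem (by fun_prop)
    have e5 : ∫ z, (2 * (b + 1 : ℂ)) * ((u z - c) * (z ^ a * (starRingEnd ℂ) z ^ b)) ∂lebDisk =
        0 := by
      rw [← e4]
      calc _ = ∫ z, (u z * (2 * (b + 1) * (z ^ a * (starRingEnd ℂ) z ^ b)) -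
            c * (2 * (b + 1) * (z ^ a * (starRingEnd ℂ) z ^ b))) ∂lebDisk :=
            integral_congr_ae (ae_of_all _ fun z => by ring)
        _ = ∫ z, (g z * (z * (z ^ a * (starRingEnd ℂ) (z ^ (b + 1)))) -
            c * (z * (z ^ a * (starRingEnd ℂ) (z ^ (b + 1))))) ∂arcLength := by
            rw [integral_sub i1 i2, integral_sub i3 i4, e1, e2]
        _ = _ := integral_congr_ae (ae_of_all _ fun z => by simp only [map_pow]; ring)
    rw [integral_const_mul] at e5
    refine (mul_eq_zero.1 e5).resolve_left ?_
    exact mul_ne_zero two_ne_zero (by exact_mod_cast b.succ_ne_zero)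
  exact key.mono fun z hz => sub_eq_zero.1 hz

/-- Green's formula for a function that satisfies the Cauchy-Riemann equation weakly. -/
theorem green_of_dbarFun_eq_zero {u g : ℂ → ℂ} (hu : MemSobolev u) (t : IsTrace u g)
    (h : dbarFun u hu = 0) {φ : ℂ → ℂ} (hφ : ContDiff ℝ ∞ φ) :
    ∫ z, u z * twoDbar φ z ∂lebDisk = ∫ z, g z * (z * φ z) ∂arcLength := by
  obtain ⟨ux, uy, s⟩ := id hu
  rw [dbarFun_eq hu s] at h
  have h1 := (smul_eq_zero.1 h).resolve_left (by norm_num)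
  have h2 : ∀ᵐ z ∂lebDisk, ux z + Complex.I * uy z = 0 := by
    rw [← MemLp.toLp_const_smul, ← MemLp.toLp_add] at h1
    have := (MemLp.toLp_eq_toLp_iff (s.memLp_x.add (s.memLp_y.const_smul Complex.I))
      MemLp.zero).1 (h1.trans (MemLp.toLp_zero _).symm)
    exact this
  rw [← green_trace t s hφ, ← integral_add (integrable_mul_test s.memLp_x hφ.continuous)
    (integrable_mul_test s.memLp_y (φ := fun z => Complex.I * φ z)
      (continuous_const.mul hφ.continuous)),
    integral_eq_zero_of_ae (f := fun z => ux z * φ z + uy z * (Complex.I * φ z))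
      (h2.mono fun z hz => ?_), add_zero]
  have : ux z * φ z + uy z * (Complex.I * φ z) = (ux z + Complex.I * uy z) * φ z := by ring
  simp only [this, hz, zero_mul, Pi.zero_apply]

theorem eq_smul_const {u : Lp ℂ 2 fsDisk} {c : ℂ} (h : u =ᵐ[lebDisk] fun _ => c) :
    u = c • Lp.const 2 fsDisk (1 : ℂ) := by
  refine Lp.ext ?_
  filter_upwards [fsDisk_le.absolutelyContinuous.ae_le h,
    Lp.coeFn_smul c (Lp.const 2 fsDisk (1 : ℂ)), Lp.coeFn_const 2 fsDisk (1 : ℂ)] with z h1 h2 h3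
  rw [h1, h2, Pi.smul_apply, h3]
  simp

/-- Elements of the kernel are constant on each disk. -/
theorem finiteDimensional_ker_dbar :
    FiniteDimensional ℂ (dbar.toFun.ker.map dbar.domain.subtype) := by
  let e : FunctionSpace := WithLp.toLp 2 (Lp.const 2 fsDisk (1 : ℂ), 0)
  let f : FunctionSpace := WithLp.toLp 2 (0, Lp.const 2 fsDisk (1 : ℂ))
  have hle : dbar.toFun.ker.map dbar.domain.subtype ≤ Submodule.span ℂ {e, f} := by
    rintro _ ⟨x, hx, rfl⟩
    obtain ⟨mu, mv, g, h, t1, t2, t3⟩ := id x.2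
    have hD : WithLp.toLp 2 (dbarFun (x : FunctionSpace).fst mu,
        dbarFun (x : FunctionSpace).snd mv) = (0 : FormSpace) := LinearMap.mem_ker.1 hx
    have h1 : dbarFun (x : FunctionSpace).fst mu = 0 := congrArg (fun y => y.fst) hD
    have h2 : dbarFun (x : FunctionSpace).snd mv = 0 := congrArg (fun y => y.snd) hD
    have g1 := fun φ hφ => green_of_dbarFun_eq_zero (φ := φ) mu t1 h1 hφ
    have g2 := fun φ hφ => green_of_dbarFun_eq_zero (φ := φ) mv t2 h2 hφ
    have mom : ∀ u g : ℂ → ℂ, (∀ φ : ℂ → ℂ, ContDiff ℝ ∞ φ →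
        ∫ z, u z * twoDbar φ z ∂lebDisk = ∫ z, g z * (z * φ z) ∂arcLength) →
        ∀ n : ℕ, ∫ z, g z * z ^ (n + 1) ∂arcLength = 0 := fun u g H n => by
      have := H _ (contDiff_pow_complex n)
      simp only [twoDbar_pow, mul_zero, integral_zero] at this
      simp only [pow_succ', ← this]
    have t3' : ∀ᵐ z ∂arcLength, h z = g (1 / z) := by
      filter_upwards [measurePreserving_inversion.quasiMeasurePreserving.ae t3] with z hz
      rw [hz, one_div_one_div]
    obtain ⟨c, hc⟩ := ae_const_of_green mu.choose_spec.choose_spec.memLp t1.1 g1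
      (mom _ _ g2) t3
    obtain ⟨d, hd⟩ := ae_const_of_green mv.choose_spec.choose_spec.memLp t2.1 g2
      (mom _ _ g1) t3'
    refine Submodule.mem_span_pair.2 ⟨c, d, (WithLp.equiv 2 _).injective (Prod.ext ?_ ?_)⟩
    · have := eq_smul_const hc
      change c • Lp.const 2 fsDisk (1 : ℂ) + d • 0 = (x : FunctionSpace).fst
      rw [smul_zero, add_zero, this]
    · have := eq_smul_const hd
      change c • 0 + d • Lp.const 2 fsDisk (1 : ℂ) = (x : FunctionSpace).snd
      rw [smul_zero, zero_add, this]
  have := FiniteDimensional.span_of_finite ℂ (Set.toFinite {e, f})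
  exact Submodule.finiteDimensional_of_le hle

/-! ### From a compact right inverse to a parametrix -/

/-- If `Q` is a right inverse of `D` and the kernel `N` of `D` is finite-dimensional, with
orthogonal projection `P`, then `(1 - P) Q` is a right inverse and `(1 - P) Q D = 1 - P`. -/
theorem exists_parametrix {E F : Type*} [NormedAddCommGroup E] [InnerProductSpace ℂ E]
    [NormedAddCommGroup F] [NormedSpace ℂ F] {D : E →ₗ.[ℂ] F} {Q : F →L[ℂ] E}
    (hQ : IsRightInverse D Q) (hc : IsCompactOperator Q)
    (hN : FiniteDimensional ℂ (D.toFun.ker.map D.domain.subtype)) :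
    ∃ Q' : F →L[ℂ] E, IsCompactOperator Q' ∧ IsRightInverse D Q' ∧
      IsLeftInverseModCompact D Q' := by
  set N := D.toFun.ker.map D.domain.subtype with hNdef
  let P : E →L[ℂ] E := N.starProjection
  have hP : IsCompactOperator P :=
    (isCompactOperator_of_locallyCompactSpace_dom N.orthogonalProjectionOnto).clm_comp N.subtypeL
  have hker : ∀ x : E, x ∈ N → ∃ h : x ∈ D.domain, D ⟨x, h⟩ = 0 := by
    rintro _ ⟨x, hx, rfl⟩
    exact ⟨x.2, LinearMap.mem_ker.1 hx⟩
  have hr : IsRightInverse D (Q - P.comp Q) := by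
    intro y
    obtain ⟨h1, e1⟩ := hQ y
    obtain ⟨h2, e2⟩ := hker (P (Q y)) (N.starProjection_apply_mem (Q y))
    refine ⟨D.domain.sub_mem h1 h2, ?_⟩
    have : D (⟨Q y, h1⟩ - ⟨P (Q y), h2⟩) = y := by rw [D.map_sub, e1, e2, sub_zero]
    exact this
  refine ⟨Q - P.comp Q, hc.sub (hc.clm_comp P), hr, -P, hP.neg, fun x => ?_⟩
  -- `Q D x - x` is in the kernel, hence fixed by the projection
  obtain ⟨h1, e1⟩ := hQ (D x)
  have hmem : Q (D x) - x ∈ N := by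
    refine ⟨⟨Q (D x), h1⟩ - x, LinearMap.mem_ker.2 ?_, rfl⟩
    have : D (⟨Q (D x), h1⟩ - x) = 0 := by rw [D.map_sub, e1, sub_self]
    exact this
  have hfix : P (Q (D x) - x) = Q (D x) - x := Submodule.starProjection_eq_self_iff.2 hmem
  rw [map_sub] at hfix
  change Q (D x) - P (Q (D x)) = x + -(P x)
  rw [sub_eq_sub_iff_add_eq_add] at hfix
  rw [← sub_eq_add_neg, sub_eq_sub_iff_add_eq_add, ← hfix, add_comm]

end GluedDisks

end

theorem mainTheorem2 :
    (∃ Q : GluedDisks.FormSpace →L[ℂ] GluedDisks.FunctionSpace,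
      GluedDisks.IsRightInverse GluedDisks.dbar Q) ∧
    (∃ Q : GluedDisks.FormSpace →L[ℂ] GluedDisks.FunctionSpace,
      GluedDisks.IsLeftInverseModCompact GluedDisks.dbar Q) ∧
    (∃ Q : GluedDisks.FormSpace →L[ℂ] GluedDisks.FunctionSpace,
      IsCompactOperator Q ∧ GluedDisks.IsParametrix GluedDisks.dbar Q ∧
      GluedDisks.IsRightInverse GluedDisks.dbar Q) := by
  obtain ⟨Q, hc, hr, hl⟩ := GluedDisks.exists_parametrix GluedDisks.isRightInverse_dbarInv
    GluedDisks.isCompactOperator_dbarInv GluedDisks.finiteDimensional_ker_dbar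
  refine ⟨⟨Q, hr⟩, ⟨Q, hl⟩, Q, hc, ⟨⟨0, isCompactOperator_zero, fun y => ?_⟩, hl⟩, hr⟩
  obtain ⟨h, e⟩ := hr y
  exact ⟨h, e.trans (add_zero y).symm⟩
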